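/- **Induced Hodge operator on the Podleś sphere.** Let $0<q<1$ and let $\mathcal A=\mathcal A(SU_q(2))$ be the unital $*$-algebra generated by $a,c$ with $uu^*=u^*u=1$ for $u=\begin{pmatrix}a&-qc^*\\c&a^*\end{pmatrix}$, with coproduct $\Delta u=u\otimes u$ and Haar state $h$ (the unital bi-invariant functional). Let $\delta_R=(\mathrm{id}\otimes\pi)\Delta$, where $\pi:\mathcal A\to\mathbb C[z,z^{-1}]$, $\pi(a)=z$, $\pi(a^*)=z^{-1}$, $\pi(c)=\pi(c^*)=0$; put $\mathcal L_n=\{x:\delta_R(x)=x\otimes z^{-n}\}$ and $\mathcal A(S^2_q)=\mathcal L_0$. Let $\Gamma$ be the $\mathcal A$-bimodule, free as a left module on $\omega_-,\omega_+,\omega_z$, with $\omega_\pm x=q^{n}x\,\omega_\pm$, $\omega_zx=q^{2n}x\,\omega_z$ for $x\in\mathcal L_n$, and with $\omega_-^*=-\omega_+$, $\omega_z^*=-\omega_z$. Let $\sigma$ be the left $\mathcal A$-linear braiding on $\Gamma\otimes_{\mathcal A}\Gamma$ with $\sigma(\omega_a\otimes\omega_a)=\omega_a\otimes\omega_a$ for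 $a\in\{-,+,z\}$ and $$\begin{aligned} \sigma(\omega_-\otimes\omega_+)&=(1-q^2)\,\omega_-\otimes\omega_++q^{-2}\omega_+\otimes\omega_-,&\sigma(\omega_+\otimes\omega_-)&=q^4\omega_-\otimes\omega_+,\\ \sigma(\omega_-\otimes\omega_z)&=(1-q^2)\,\omega_-\otimes\omega_z+q^{-4}\omega_z\otimes\omega_-,&\sigma(\omega_z\otimes\omega_-)&=q^6\omega_-\otimes\omega_z,\\ \sigma(\omega_z\otimes\omega_+)&=(1-q^2)\,\omega_z\otimes\omega_++q^{-4}\omega_+\otimes\omega_z,&\sigma(\omega_+\otimes\omega_z)&=q^6\omega_z\otimes\omega_+. \end{aligned}$$ Put $A^{(0)}=A^{(1)}=1$, $A^{(2)}=1-\sigma$, $A^{(3)}=(1-\sigma_2)(1-\sigma_1+\sigma_1\sigma_2)$ (with $\sigma_1=\sigma\otimes1$, $\sigma_2=1\otimes\sigma$), and let $\Gamma^{\wedge}=\bigoplus_{k=0}^3\mathrm{Range}\,A^{(k)}$ be the exterior algebra, with the wedge product induced by $\otimes_{\mathcal A}$ and the antilinear conjugation determined by $(\phi\wedge\psi)^*=(-1)^{kl}\psi^*\wedge\phi^*$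 for $\phi,\psi$ of degrees $k,l$. Put $\theta=\omega_-\wedge\omega_+\wedge\omega_z$, $\lambda_0=\lambda_1=1$, $\lambda_2=1+q^2$, $\lambda_3=1+2q^2+2q^4+q^6$. A non degenerate bilinear form $g$ on $\mathrm{span}_{\mathbb C}(\omega_-,\omega_+,\omega_z)$ which is right $U(1)$-invariant (its only possibly non zero entries are $\alpha=g(\omega_-,\omega_+)$, $\beta=g(\omega_+,\omega_-)$, $\gamma=g(\omega_z,\omega_z)$) is extended to left invariant antisymmetric tensors by $g(\omega_{a_1}\otimes\cdots\otimes\omega_{a_k},\omega_{b_1}\otimes\cdots\otimes\omega_{b_k})=\prod_jg(\omega_{a_j},\omega_{b_j})$, and gives the scalar product $\langle x\omega,x'\omega'\rangle=h(x^*x')\,\lambda_k^{-1}g(\omega^*,\omega')$ for $x,x'\in\mathcal A$ and left invariant $\omega,\omega'\in\Gamma^{\wedge k}$, different degrees being orthogonal. For a real $m\ne0$ and $\mu=m\theta$, its dual operator is the left $\mathcal A$-linear $T:\Gamma^{\wedge k}\to\Gamma^{\wedge(3-k)}$ with $\langle\phi,\phi'\rangle=\int_\mu\phi^*\wedge T(\phi')$,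 where $\int_\mu x\mu=h(x)$. Let $\mathfrak G_\sigma$ be the set of those $g$ which are symmetric ($T^2$ is a constant multiple of the identity on $\Gamma$) and real ($T(\omega_a^*)=T(\omega_a)^*$ for $a\in\{-,+,z\}$). Let $g\in\mathfrak G_\sigma$, let $\check m\ne0$ be real, put $\check\mu=i\check m\,\omega_-\wedge\omega_+$ and restrict the scalar product to $$\Omega(S^2_q)=\mathcal A(S^2_q)\oplus(\mathcal L_{-2}\,\omega_-\oplus\mathcal L_{2}\,\omega_+)\oplus\mathcal A(S^2_q)\,\omega_-\wedge\omega_+ .$$ There is exactly one map $\check T:\Omega(S^2_q)\to\Omega(S^2_q)$ with $\langle\psi,\psi'\rangle=\int_{\check\mu}\psi^*\wedge\check T(\psi')$ for all $\psi,\psi'$, where $\int_{\check\mu}$ vanishes in degrees other than $2$ and $\int_{\check\mu}f\check\mu=h(f)$. It is left $\mathcal A(S^2_q)$-linear, maps $\Omega^s(S^2_q)$ to $\Omega^{2-s}(S^2_q)$, and, for $v_\pm\in\mathcal L_{\pm2}$, $$\check T(1)=i\check m\,\omega_-\wedge\omega_+,\qquad \check T(v_-\omega_-)=-iq^{-2}\check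 m\beta\,v_-\omega_-,\qquad \check T(v_+\omega_+)=i\check m\alpha\,v_+\omega_+,\qquad \check T(\omega_-\wedge\omega_+)=-\frac{2i\check m\alpha\beta}{\lambda_2}.$$ The operator $\check T^2$ is diagonal: it is multiplication by $2\check m^2\alpha\beta/\lambda_2$ on $\Omega^0$ and on $\Omega^2$, by $-q^{-4}\check m^2\beta^2$ on $\mathcal L_{-2}\omega_-$ and by $-\check m^2\alpha^2$ on $\mathcal L_2\omega_+$. It is not a constant multiple of the identity on $\Omega^1(S^2_q)$. In particular this holds for each of the following two normalisations, both of which are attained by some real $\check m\neq0$. If $\check m^2=\lambda_2\alpha\beta/2$, the four eigenvalues, on $\Omega^0$, $\Omega^2$, $\mathcal L_{-2}\omega_-$, $\mathcal L_{2}\omega_+$, are $(\alpha\beta)^2$, $(\alpha\beta)^2$, $-\lambda_2\alpha\beta^3/(2q^4)$, $-\lambda_2\alpha^3\beta/2$. If $\check m^2=\lambda_2/(2\alpha\beta)$, they are $1$, $1$, $-q^2\lambda_2/2$, $-\lambda_2/(2q^6)$. -/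

import Mathlib

namespace PodlesHodge

open scoped TensorProduct LaurentPolynomial

noncomputable section

/-- The deformation parameter `0 < q < 1`. -/
abbrev Param : Type := Set.Ioo (0 : ℝ) 1

/-- The parameter as a complex number. -/
def cq (q : Param) : ℂ := ((q : ℝ) : ℂ)

theorem cq_ne_zero (q : Param) : cq q ≠ 0 := by
  have := q.2.1
  simp [cq, this.ne']

theorem conj_cq (q : Param) : (starRingEnd ℂ) (cq q) = cq q := Complex.conj_ofReal _

/-! ### The algebra of polynomial functions on quantum SU(2) -/

/-- The symbols `a`, `a*`, `c`, `c*`. -/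
inductive Gen : Type
  | a | as | c | cs

/-- The matrix `u = ((a, -q c*), (c, a*))` with entries in an algebra. -/
def matU {B : Type*} [Ring B] [Algebra ℂ B] (q : Param) (f : Gen → B) :
    Matrix (Fin 2) (Fin 2) B :=
  !![f .a, -(cq q • f .cs); f .c, f .as]

/-- The adjoint matrix `u* = ((a*, c*), (-q c, a))`. -/
def matUstar {B : Type*} [Ring B] [Algebra ℂ B] (q : Param) (f : Gen → B) :
    Matrix (Fin 2) (Fin 2) B :=
  !![f .as, f .cs; -(cq q • f .c), f .a]

/-- The relations `u u* = 1 = u* u`. -/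
inductive Rel (q : Param) : FreeAlgebra ℂ Gen → FreeAlgebra ℂ Gen → Prop
  | left (i j : Fin 2) : Rel q
      ((matU q (FreeAlgebra.ι ℂ) * matUstar q (FreeAlgebra.ι ℂ)) i j)
      ((1 : Matrix (Fin 2) (Fin 2) (FreeAlgebra ℂ Gen)) i j)
  | right (i j : Fin 2) : Rel q
      ((matUstar q (FreeAlgebra.ι ℂ) * matU q (FreeAlgebra.ι ℂ)) i j)
      ((1 : Matrix (Fin 2) (Fin 2) (FreeAlgebra ℂ Gen)) i j)

/-- The unital algebra generated by `a, a*, c, c*` with `u u* = u* u = 1`. -/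
def ASU (q : Param) : Type := RingQuot (Rel q)

instance (q : Param) : Ring (ASU q) := inferInstanceAs (Ring (RingQuot (Rel q)))
instance (q : Param) : Algebra ℂ (ASU q) := inferInstanceAs (Algebra ℂ (RingQuot (Rel q)))

/-- The quotient map from the free algebra. -/
def mkASU (q : Param) : FreeAlgebra ℂ Gen →ₐ[ℂ] ASU q := RingQuot.mkAlgHom ℂ (Rel q)

/-- The generators of the algebra. -/
def gen (q : Param) (x : Gen) : ASU q := mkASU q (FreeAlgebra.ι ℂ x)

theorem matU_map {B C : Type*} [Ring B] [Algebra ℂ B] [Ring C] [Algebra ℂ C] (q : Param)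
    (φ : B →ₐ[ℂ] C) (f : Gen → B) : (matU q f).map φ = matU q (fun x => φ (f x)) := by
  ext i j; fin_cases i <;> fin_cases j <;> simp [matU]

theorem matUstar_map {B C : Type*} [Ring B] [Algebra ℂ B] [Ring C] [Algebra ℂ C] (q : Param)
    (φ : B →ₐ[ℂ] C) (f : Gen → B) : (matUstar q f).map φ = matUstar q (fun x => φ (f x)) := by
  ext i j; fin_cases i <;> fin_cases j <;> simp [matUstar]

theorem matU_mul_matUstar (q : Param) : matU q (gen q) * matUstar q (gen q) = 1 := by
  have h : matU q (gen q) * matUstar q (gen q)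
      = (matU q (FreeAlgebra.ι ℂ) * matUstar q (FreeAlgebra.ι ℂ)).map (mkASU q) := by
    rw [Matrix.map_mul, matU_map, matUstar_map]; rfl
  rw [h]
  ext i j
  rw [Matrix.map_apply]
  have e : mkASU q _ = mkASU q _ := RingQuot.mkAlgHom_rel ℂ (Rel.left (q := q) i j)
  rw [e]
  fin_cases i <;> fin_cases j <;> simp

theorem matUstar_mul_matU (q : Param) : matUstar q (gen q) * matU q (gen q) = 1 := by
  have h : matUstar q (gen q) * matU q (gen q)
      = (matUstar q (FreeAlgebra.ι ℂ) * matU q (FreeAlgebra.ι ℂ)).map (mkASU q) := by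
    rw [Matrix.map_mul, matU_map, matUstar_map]; rfl
  rw [h]
  ext i j
  rw [Matrix.map_apply]
  have e : mkASU q _ = mkASU q _ := RingQuot.mkAlgHom_rel ℂ (Rel.right (q := q) i j)
  rw [e]
  fin_cases i <;> fin_cases j <;> simp

/-- The universal property: an assignment of the generators whose matrices satisfy the
relations extends to an algebra homomorphism. -/
def liftASU {B : Type*} [Ring B] [Algebra ℂ B] (q : Param) (f : Gen → B)
    (h₁ : matU q f * matUstar q f = 1) (h₂ : matUstar q f * matU q f = 1) : ASU q →ₐ[ℂ] B :=
  RingQuot.liftAlgHom ℂ ⟨FreeAlgebra.lift ℂ f, by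
    have hU : matU q f = (matU q (FreeAlgebra.ι ℂ)).map (FreeAlgebra.lift ℂ f) := by
      rw [matU_map]; simp
    have hV : matUstar q f = (matUstar q (FreeAlgebra.ι ℂ)).map (FreeAlgebra.lift ℂ f) := by
      rw [matUstar_map]; simp
    intro x y hxy
    cases hxy with
    | left i j =>
      rw [← Matrix.map_apply (f := FreeAlgebra.lift ℂ f), Matrix.map_mul, ← hU, ← hV, h₁]
      fin_cases i <;> fin_cases j <;> simp
    | right i j =>
      rw [← Matrix.map_apply (f := FreeAlgebra.lift ℂ f), Matrix.map_mul, ← hU, ← hV, h₂]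
      fin_cases i <;> fin_cases j <;> simp⟩

@[simp] theorem liftASU_gen {B : Type*} [Ring B] [Algebra ℂ B] (q : Param) (f : Gen → B)
    (h₁ : matU q f * matUstar q f = 1) (h₂ : matUstar q f * matU q f = 1) (x : Gen) :
    liftASU q f h₁ h₂ (gen q x) = f x := by
  refine (RingQuot.liftAlgHom_mkAlgHom_apply ℂ _ _ _).trans ?_
  simp

theorem ASU_hom_ext {B : Type*} [Ring B] [Algebra ℂ B] (q : Param) {φ ψ : ASU q →ₐ[ℂ] B}
    (h : ∀ x, φ (gen q x) = ψ (gen q x)) : φ = ψ := by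
  refine RingQuot.ringQuot_ext' ℂ _ _ (FreeAlgebra.hom_ext ?_)
  funext x
  exact h x

/-- The opposite algebra with the conjugate action of the scalars. -/
def ConjOp (B : Type*) : Type _ := Bᵐᵒᵖ

instance (B : Type*) [Ring B] : Ring (ConjOp B) := inferInstanceAs (Ring Bᵐᵒᵖ)

instance (B : Type*) [Ring B] [Algebra ℂ B] : Algebra ℂ (ConjOp B) :=
  RingHom.toAlgebra' ((algebraMap ℂ Bᵐᵒᵖ).comp (starRingEnd ℂ)) (fun c x =>
    Algebra.commutes (A := Bᵐᵒᵖ) ((starRingEnd ℂ) c) x)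

/-- The canonical map to `ConjOp B`. -/
def toConjOp {B : Type*} (x : B) : ConjOp B := MulOpposite.op x

/-- The canonical map from `ConjOp B`. -/
def ofConjOp {B : Type*} (x : ConjOp B) : B := MulOpposite.unop x

theorem toConjOp_add {B : Type*} [Ring B] (x y : B) :
    toConjOp (x + y) = toConjOp x + toConjOp y := rfl
theorem toConjOp_neg {B : Type*} [Ring B] (x : B) : toConjOp (-x) = -toConjOp x := rfl
theorem toConjOp_mul {B : Type*} [Ring B] (x y : B) :
    toConjOp (x * y) = toConjOp y * toConjOp x := rfl
theorem toConjOp_one {B : Type*} [Ring B] : toConjOp (1 : B) = 1 := rfl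
theorem toConjOp_zero {B : Type*} [Ring B] : toConjOp (0 : B) = 0 := rfl
theorem toConjOp_smul {B : Type*} [Ring B] [Algebra ℂ B] (c : ℂ) (x : B) :
    toConjOp (c • x) = (starRingEnd ℂ c) • toConjOp x := by
  rw [Algebra.smul_def (A := ConjOp B), Algebra.smul_def, Algebra.commutes (A := B) c x,
    toConjOp_mul]
  change _ = MulOpposite.op (algebraMap ℂ B (starRingEnd ℂ (starRingEnd ℂ c))) * _
  rw [Complex.conj_conj]; rfl

/-- The images of the generators under the involution. -/
def genStar (q : Param) : Gen → ConjOp (ASU q)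
  | .a => toConjOp (gen q .as)
  | .as => toConjOp (gen q .a)
  | .c => toConjOp (gen q .cs)
  | .cs => toConjOp (gen q .c)

theorem matU_genStar (q : Param) : matU q (genStar q) = (matUstar q (gen q)).transpose.map toConjOp := by
  ext i j
  fin_cases i <;> fin_cases j <;>
    simp [matU, matUstar, genStar, toConjOp_neg, toConjOp_smul, conj_cq]

theorem matUstar_genStar (q : Param) : matUstar q (genStar q) = (matU q (gen q)).transpose.map toConjOp := by
  ext i j
  fin_cases i <;> fin_cases j <;>
    simp [matU, matUstar, genStar, toConjOp_neg, toConjOp_smul, conj_cq]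

theorem transpose_map_toConjOp_mul {B : Type*} [Ring B] (M N : Matrix (Fin 2) (Fin 2) B) :
    M.transpose.map toConjOp * N.transpose.map toConjOp = (N * M).transpose.map toConjOp := by
  ext i j
  simp [Matrix.mul_apply, toConjOp_add, toConjOp_mul]

theorem one_transpose_map_toConjOp {B : Type*} [Ring B] :
    (1 : Matrix (Fin 2) (Fin 2) B).transpose.map toConjOp = 1 := by
  ext i j
  fin_cases i <;> fin_cases j <;> simp [toConjOp_one, toConjOp_zero]

/-- The involution, as a homomorphism to the conjugate opposite algebra. -/
def starHom (q : Param) : ASU q →ₐ[ℂ] ConjOp (ASU q) :=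
  liftASU q (genStar q)
    (by rw [matU_genStar, matUstar_genStar, transpose_map_toConjOp_mul, matU_mul_matUstar,
      one_transpose_map_toConjOp])
    (by rw [matU_genStar, matUstar_genStar, transpose_map_toConjOp_mul, matUstar_mul_matU,
      one_transpose_map_toConjOp])

/-- The `*`-operation: antilinear, antimultiplicative, exchanging `a, a*` and `c, c*`. -/
instance (q : Param) : Star (ASU q) := ⟨fun x => ofConjOp (starHom q x)⟩

theorem star_def (q : Param) (x : ASU q) : star x = ofConjOp (starHom q x) := rfl

theorem star_gen (q : Param) (x : Gen) : star (gen q x) = ofConjOp (genStar q x) := by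
  rw [star_def, starHom, liftASU_gen]

theorem ASU_induction (q : Param) {P : ASU q → Prop}
    (algebraMap : ∀ r : ℂ, P (algebraMap ℂ (ASU q) r)) (gen : ∀ x, P (gen q x))
    (mul : ∀ x y, P x → P y → P (x * y)) (add : ∀ x y, P x → P y → P (x + y)) (x : ASU q) :
    P x := by
  obtain ⟨y, rfl⟩ : ∃ y, mkASU q y = x := RingQuot.mkAlgHom_surjective ℂ (Rel q) x
  induction y with
  | grade0 r => rw [AlgHom.commutes]; exact algebraMap r
  | grade1 x => exact gen x
  | mul x y hx hy => rw [map_mul]; exact mul _ _ hx hy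
  | add x y hx hy => rw [map_add]; exact add _ _ hx hy

theorem star_algebraMap' (q : Param) (r : ℂ) :
    star (algebraMap ℂ (ASU q) r) = algebraMap ℂ (ASU q) (starRingEnd ℂ r) := by
  rw [star_def, AlgHom.commutes]; rfl

theorem star_mul' (q : Param) (x y : ASU q) : star (x * y) = star y * star x := by
  rw [star_def, map_mul]; rfl

theorem star_add' (q : Param) (x y : ASU q) : star (x + y) = star x + star y := by
  rw [star_def, map_add]; rfl

instance (q : Param) : StarRing (ASU q) where
  star_involutive x := by
    induction x using ASU_induction with
    | algebraMap r => rw [star_algebraMap', star_algebraMap', Complex.conj_conj]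
    | gen x => cases x <;> simp only [star_gen, genStar, ofConjOp, toConjOp, MulOpposite.unop_op]
    | mul x y hx hy => rw [star_mul', star_mul', hx, hy]
    | add x y hx hy => rw [star_add', star_add', hx, hy]
  star_mul := star_mul' q
  star_add := star_add' q

instance (q : Param) : StarModule ℂ (ASU q) where
  star_smul r x := by
    rw [Algebra.smul_def, star_mul, star_algebraMap', Algebra.smul_def, Algebra.commutes]; rfl

/-! ### Coproduct, coaction of U(1), line bundles and Haar state -/

/-- The coproduct on the generators, i.e. the entries of `Δ u = u ⊗ u`. -/
def genComul (q : Param) : Gen → ASU q ⊗[ℂ] ASU q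
  | .a => gen q .a ⊗ₜ gen q .a - cq q • (gen q .cs ⊗ₜ gen q .c)
  | .as => gen q .as ⊗ₜ gen q .as - cq q • (gen q .c ⊗ₜ gen q .cs)
  | .c => gen q .c ⊗ₜ gen q .a + gen q .as ⊗ₜ gen q .c
  | .cs => gen q .cs ⊗ₜ gen q .as + gen q .a ⊗ₜ gen q .cs

/-- The left leg embedding. -/
abbrev inL (q : Param) : ASU q →ₐ[ℂ] ASU q ⊗[ℂ] ASU q := Algebra.TensorProduct.includeLeft
/-- The right leg embedding. -/
abbrev inR (q : Param) : ASU q →ₐ[ℂ] ASU q ⊗[ℂ] ASU q := Algebra.TensorProduct.includeRight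

theorem matU_genComul (q : Param) : matU q (genComul q) =
    (matU q (gen q)).map (inL q) * (matU q (gen q)).map (inR q) := by
  ext i j
  fin_cases i <;> fin_cases j <;>
    simp [matU, genComul, Matrix.mul_apply, TensorProduct.smul_tmul', TensorProduct.tmul_smul,
      TensorProduct.neg_tmul, TensorProduct.tmul_neg, sub_eq_add_neg, smul_add, add_comm]

theorem matUstar_genComul (q : Param) : matUstar q (genComul q) =
    (matUstar q (gen q)).map (inR q) * (matUstar q (gen q)).map (inL q) := by
  ext i j
  fin_cases i <;> fin_cases j <;>
    simp [matUstar, genComul, Matrix.mul_apply, TensorProduct.smul_tmul', TensorProduct.tmul_smul,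
      TensorProduct.neg_tmul, TensorProduct.tmul_neg, sub_eq_add_neg, smul_add, add_comm]

theorem map_one_matrix {B C : Type*} [Ring B] [Algebra ℂ B] [Ring C] [Algebra ℂ C]
    (φ : B →ₐ[ℂ] C) : (1 : Matrix (Fin 2) (Fin 2) B).map φ = 1 := by
  ext i j
  fin_cases i <;> fin_cases j <;> simp

/-- The coproduct, `Δ u = u ⊗ u`. -/
def comul (q : Param) : ASU q →ₐ[ℂ] ASU q ⊗[ℂ] ASU q :=
  liftASU q (genComul q)
    (by
      rw [matU_genComul, matUstar_genComul, Matrix.mul_assoc, ← Matrix.mul_assoc (Matrix.map _ (inR q)),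
        ← Matrix.map_mul, matU_mul_matUstar, map_one_matrix, Matrix.one_mul, ← Matrix.map_mul,
        matU_mul_matUstar, map_one_matrix])
    (by
      rw [matU_genComul, matUstar_genComul, Matrix.mul_assoc, ← Matrix.mul_assoc (Matrix.map _ (inL q)),
        ← Matrix.map_mul, matUstar_mul_matU, map_one_matrix, Matrix.one_mul, ← Matrix.map_mul,
        matUstar_mul_matU, map_one_matrix])

/-- The projection on the generators: `a ↦ z`, `a* ↦ z⁻¹`, `c, c* ↦ 0`. -/
def genProj : Gen → ℂ[T;T⁻¹]
  | .a => LaurentPolynomial.T 1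
  | .as => LaurentPolynomial.T (-1)
  | .c => 0
  | .cs => 0

theorem T_one_mul_T_neg_one :
    (LaurentPolynomial.T 1 * LaurentPolynomial.T (-1) : ℂ[T;T⁻¹]) = 1 := by
  rw [← LaurentPolynomial.T_add, add_neg_cancel, LaurentPolynomial.T_zero]

theorem T_neg_one_mul_T_one :
    (LaurentPolynomial.T (-1) * LaurentPolynomial.T 1 : ℂ[T;T⁻¹]) = 1 := by
  rw [← LaurentPolynomial.T_add, neg_add_cancel, LaurentPolynomial.T_zero]

/-- The surjection `π` onto the algebra `ℂ[z, z⁻¹]` of functions on U(1). -/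
def proj (q : Param) : ASU q →ₐ[ℂ] ℂ[T;T⁻¹] :=
  liftASU q genProj
    (by
      rw [matU, matUstar, Matrix.mul_fin_two, Matrix.one_fin_two]
      simp only [genProj, smul_zero, neg_zero, mul_zero, zero_mul, add_zero, zero_add,
        T_one_mul_T_neg_one, T_neg_one_mul_T_one])
    (by
      rw [matU, matUstar, Matrix.mul_fin_two, Matrix.one_fin_two]
      simp only [genProj, smul_zero, neg_zero, mul_zero, zero_mul, add_zero, zero_add,
        T_one_mul_T_neg_one, T_neg_one_mul_T_one])

/-- The right coaction `δ_R = (id ⊗ π) Δ` of U(1). -/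
def coact (q : Param) : ASU q →ₐ[ℂ] ASU q ⊗[ℂ] ℂ[T;T⁻¹] :=
  (Algebra.TensorProduct.map (AlgHom.id ℂ (ASU q)) (proj q)).comp (comul q)

/-- The line bundle `L_n = {x : δ_R x = x ⊗ z⁻ⁿ}`. -/
def line (q : Param) (n : ℤ) : Submodule ℂ (ASU q) where
  carrier := {x | coact q x = x ⊗ₜ LaurentPolynomial.T (-n)}
  add_mem' {x y} hx hy := by
    simp only [Set.mem_ofPred_eq] at *
    rw [map_add, hx, hy, TensorProduct.add_tmul]
  zero_mem' := by simp
  smul_mem' r x hx := by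
    simp only [Set.mem_ofPred_eq] at *
    rw [map_smul, hx, TensorProduct.smul_tmul']

theorem mem_line (q : Param) (n : ℤ) (x : ASU q) :
    x ∈ line q n ↔ coact q x = x ⊗ₜ LaurentPolynomial.T (-n) := Iff.rfl

theorem mul_mem_line (q : Param) {m n : ℤ} {x y : ASU q} (hx : x ∈ line q m)
    (hy : y ∈ line q n) : x * y ∈ line q (m + n) := by
  rw [mem_line] at *
  rw [map_mul, hx, hy, Algebra.TensorProduct.tmul_mul_tmul, ← LaurentPolynomial.T_add, neg_add]

/-- The algebra `A(S²_q) = L_0` of the standard Podleś sphere. -/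
def sphere (q : Param) : Subalgebra ℂ (ASU q) where
  __ := line q 0
  mul_mem' {x y} hx hy := mul_mem_line q (m := 0) (n := 0) hx hy
  algebraMap_mem' r := by
    change coact q (algebraMap ℂ (ASU q) r) = _
    rw [AlgHom.commutes, neg_zero, LaurentPolynomial.T_zero]
    rfl

theorem mem_sphere (q : Param) (x : ASU q) : x ∈ sphere q ↔ x ∈ line q 0 := Iff.rfl

/-- Unital functionals that are left and right invariant under the coproduct. -/
def IsHaarState (q : Param) (h : ASU q →ₗ[ℂ] ℂ) : Prop :=
  h 1 = 1 ∧
  (∀ x, TensorProduct.rid ℂ (ASU q) (TensorProduct.map LinearMap.id h (comul q x)) = h x • 1) ∧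
  (∀ x, TensorProduct.lid ℂ (ASU q) (TensorProduct.map h LinearMap.id (comul q x)) = h x • 1)

/-- The Haar state: the (unique) unital bi-invariant functional. -/
def haar (q : Param) : ASU q →ₗ[ℂ] ℂ := Classical.epsilon (IsHaarState q)


/-! ### The three dimensional calculus and its exterior algebra -/

/-- The evaluation `z ↦ q⁻ᵏ` on `ℂ[z, z⁻¹]`. -/
def evalU1 (q : Param) (k : ℤ) : ℂ[T;T⁻¹] →ₐ[ℂ] ℂ :=
  AddMonoidAlgebra.lift ℂ ℂ ℤ
    ((Units.coeHom ℂ).comp (zpowersHom ℂˣ (Units.mk0 (cq q) (cq_ne_zero q) ^ (-k))))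

theorem evalU1_T (q : Param) (k n : ℤ) :
    evalU1 q k (LaurentPolynomial.T n) = cq q ^ (-(k * n)) := by
  unfold evalU1 LaurentPolynomial.T
  rw [AddMonoidAlgebra.lift_single, one_smul]
  simp only [MonoidHom.coe_comp, Function.comp_apply, zpowersHom_apply, toAdd_ofAdd,
    Units.coeHom_apply, Units.val_zpow_eq_zpow_val, Units.val_mk0]
  rw [← zpow_mul, neg_mul]

/-- The automorphism which multiplies `L_n` by `q^(k n)`. -/
def twist (q : Param) (k : ℤ) : ASU q →ₐ[ℂ] ASU q :=
  (Algebra.TensorProduct.rid ℂ ℂ (ASU q)).toAlgHom.comp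
    ((Algebra.TensorProduct.map (AlgHom.id ℂ (ASU q)) (evalU1 q k)).comp (coact q))

theorem twist_of_mem_line (q : Param) (k n : ℤ) {x : ASU q} (hx : x ∈ line q n) :
    twist q k x = cq q ^ (k * n) • x := by
  rw [mem_line] at hx
  simp only [twist, AlgHom.comp_apply, hx, Algebra.TensorProduct.map_tmul, evalU1_T]
  simp

theorem twist_twist (q : Param) (k l : ℤ) (x : ASU q) :
    twist q k (twist q l x) = twist q (k + l) x := by
  have hg : ∀ y : Gen, ∃ n : ℤ, gen q y ∈ line q n := by
    intro y
    cases y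
    · exact ⟨-1, by
        simp [mem_line, coact, comul, genComul, proj, genProj]⟩
    · exact ⟨1, by
        simp [mem_line, coact, comul, genComul, proj, genProj]⟩
    · exact ⟨-1, by
        simp [mem_line, coact, comul, genComul, proj, genProj]⟩
    · exact ⟨1, by
        simp [mem_line, coact, comul, genComul, proj, genProj]⟩
  have : (twist q k).comp (twist q l) = twist q (k + l) := by
    refine ASU_hom_ext q fun y => ?_
    obtain ⟨n, hn⟩ := hg y
    rw [AlgHom.comp_apply, twist_of_mem_line q l n hn, map_smul, twist_of_mem_line q k n hn,
      twist_of_mem_line q (k + l) n hn, smul_smul, ← zpow_add₀ (cq_ne_zero q)]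
    congr 2; ring
  exact DFunLike.congr_fun this x

/-- The labels of the basic left invariant one-forms `ω₋, ω₊, ω_z`. -/
inductive Idx : Type
  | minus | plus | zed
  deriving DecidableEq

instance : Fintype Idx := ⟨{.minus, .plus, .zed}, by intro x; cases x <;> decide⟩

theorem sum_idx {M : Type*} [AddCommMonoid M] (f : Idx → M) :
    ∑ a, f a = f .minus + (f .plus + f .zed) := by
  change ∑ a ∈ ({.minus, .plus, .zed} : Finset Idx), f a = _
  rw [Finset.sum_insert (by decide), Finset.sum_insert (by decide), Finset.sum_singleton]

/-- The commutation `ω_a x = q^(kap a * n) x ω_a` for `x ∈ L_n`. -/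
def kap : Idx → ℤ
  | .minus => 1
  | .plus => 1
  | .zed => 2

/-- The map `τ_a` with `ω_a x = τ_a(x) ω_a`. -/
def tau (q : Param) (a : Idx) : ASU q →ₐ[ℂ] ASU q := twist q (kap a)

/-- `ω_a* = - ω_(bar a)`. -/
def bar : Idx → Idx
  | .minus => .plus
  | .plus => .minus
  | .zed => .zed

/-- The U(1)-degrees of the basic one-forms. -/
def charge : Idx → ℤ
  | .minus => -2
  | .plus => 2
  | .zed => 0

/-- The basic tensor `ω_a ⊗ ω_b`, by its coefficients. -/
def ee (a b : Idx) : Idx → Idx → ℂ := Pi.single a (Pi.single b 1)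

/-- `σ(ω_a ⊗ ω_b)`. -/
def braid (q : Param) : Idx → Idx → (Idx → Idx → ℂ)
  | .minus, .minus => ee .minus .minus
  | .plus, .plus => ee .plus .plus
  | .zed, .zed => ee .zed .zed
  | .minus, .plus => (1 - cq q ^ 2) • ee .minus .plus + (cq q ^ 2)⁻¹ • ee .plus .minus
  | .plus, .minus => cq q ^ 4 • ee .minus .plus
  | .minus, .zed => (1 - cq q ^ 2) • ee .minus .zed + (cq q ^ 4)⁻¹ • ee .zed .minus
  | .zed, .minus => cq q ^ 6 • ee .minus .zed
  | .zed, .plus => (1 - cq q ^ 2) • ee .zed .plus + (cq q ^ 4)⁻¹ • ee .plus .zed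
  | .plus, .zed => cq q ^ 6 • ee .zed .plus

/-- `Γ`: the coefficients `x_a` of `∑ x_a ω_a`. -/
abbrev G1 (q : Param) : Type := Idx → ASU q
/-- `Γ ⊗ Γ` over the algebra: the coefficients `x_ab` of `∑ x_ab ω_a ⊗ ω_b`. -/
abbrev G2 (q : Param) : Type := Idx → Idx → ASU q
/-- `Γ ⊗ Γ ⊗ Γ` over the algebra. -/
abbrev G3 (q : Param) : Type := Idx → Idx → Idx → ASU q

/-- The tensor algebra of `Γ` up to degree three. -/
abbrev Tens (q : Param) : Type := ASU q × G1 q × G2 q × G3 q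

/-- The left linear extension of `σ` to `Γ ⊗ Γ`. -/
def sig (q : Param) : G2 q →ₗ[ASU q] G2 q where
  toFun ξ c d := ∑ a, ∑ b, braid q a b c d • ξ a b
  map_add' ξ η := by
    funext c d
    simp only [Pi.add_apply, smul_add, Finset.sum_add_distrib]
  map_smul' x ξ := by
    funext c d
    simp only [Pi.smul_apply, smul_eq_mul, RingHom.id_apply, Finset.mul_sum, mul_smul_comm]

/-- `σ₁ = σ ⊗ 1`. -/
def sig1 (q : Param) : G3 q →ₗ[ASU q] G3 q where
  toFun ξ a b c := sig q (fun a' b' => ξ a' b' c) a b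
  map_add' ξ η := by
    funext a b c
    exact congrFun (congrFun (map_add (sig q) (fun a' b' => ξ a' b' c) (fun a' b' => η a' b' c)) a) b
  map_smul' x ξ := by
    funext a b c
    exact congrFun (congrFun (map_smul (sig q) x (fun a' b' => ξ a' b' c)) a) b

/-- `σ₂ = 1 ⊗ σ`. -/
def sig2 (q : Param) : G3 q →ₗ[ASU q] G3 q where
  toFun ξ a := sig q (ξ a)
  map_add' ξ η := by
    funext a
    exact map_add (sig q) (ξ a) (η a)
  map_smul' x ξ := by
    funext a
    exact map_smul (sig q) x (ξ a)

/-- The antisymmetriser `A⁽²⁾ = 1 - σ`. -/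
def asym2 (q : Param) : Module.End (ASU q) (G2 q) := 1 - sig q

/-- The antisymmetriser `A⁽³⁾ = (1 - σ₂)(1 - σ₁ + σ₁ σ₂)`. -/
def asym3 (q : Param) : Module.End (ASU q) (G3 q) :=
  (1 - (sig2 q : Module.End (ASU q) (G3 q))) *
    (1 - (sig1 q : Module.End (ASU q) (G3 q)) + (sig1 q : Module.End (ASU q) (G3 q)) * sig2 q)

/-- The antisymmetriser in all degrees `0, 1, 2, 3`. -/
def asym (q : Param) : Tens q →ₗ[ASU q] Tens q :=
  LinearMap.prodMap LinearMap.id (LinearMap.prodMap LinearMap.id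
    (LinearMap.prodMap (asym2 q) (asym3 q)))

/-- The exterior algebra `Γ^∧`, the range of the antisymmetriser. -/
def Ext (q : Param) : Type := LinearMap.range (asym q)

instance (q : Param) : AddCommGroup (Ext q) :=
  inferInstanceAs (AddCommGroup (LinearMap.range (asym q)))
instance (q : Param) : Module (ASU q) (Ext q) :=
  inferInstanceAs (Module (ASU q) (LinearMap.range (asym q)))
instance (q : Param) : Module ℂ (Ext q) :=
  inferInstanceAs (Module ℂ (LinearMap.range (asym q)))
instance (q : Param) : IsScalarTower ℂ (ASU q) (Ext q) :=
  inferInstanceAs (IsScalarTower ℂ (ASU q) (LinearMap.range (asym q)))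

/-- The exterior forms as antisymmetric tensors. -/
def tens (q : Param) : Ext q →ₗ[ASU q] Tens q := (LinearMap.range (asym q)).subtype

/-- The class in the exterior algebra of a tensor, `ω_a ⊗ ω_b ↦ ω_a ∧ ω_b`. -/
def toExt (q : Param) : Tens q →ₗ[ASU q] Ext q := (asym q).rangeRestrict

theorem tens_toExt (q : Param) (ξ : Tens q) : tens q (toExt q ξ) = asym q ξ := rfl

theorem tens_injective (q : Param) : Function.Injective (tens q) :=
  (LinearMap.range (asym q)).subtype_injective

theorem toExt_surjective (q : Param) : Function.Surjective (toExt q) :=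
  (asym q).surjective_rangeRestrict

/-- A tensor representing an exterior form. -/
def rep (q : Param) (φ : Ext q) : Tens q := Classical.choose (toExt_surjective q φ)

theorem toExt_rep (q : Param) (φ : Ext q) : toExt q (rep q φ) = φ :=
  Classical.choose_spec (toExt_surjective q φ)

/-- The product of the (truncated) tensor algebra over `ASU q`, with `ω_a x = τ_a(x) ω_a`. -/
def tmul (q : Param) (ξ η : Tens q) : Tens q :=
  (ξ.1 * η.1,
   fun a => ξ.1 * η.2.1 a + ξ.2.1 a * tau q a η.1,
   fun a b => ξ.1 * η.2.2.1 a b + ξ.2.1 a * tau q a (η.2.1 b)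
     + ξ.2.2.1 a b * tau q a (tau q b η.1),
   fun a b c => ξ.1 * η.2.2.2 a b c + ξ.2.1 a * tau q a (η.2.2.1 b c)
     + ξ.2.2.1 a b * tau q a (tau q b (η.2.1 c))
     + ξ.2.2.2 a b c * tau q a (tau q b (tau q c η.1)))

/-- The graded involution on tensors: antilinear, `(φ ⊗ ψ)* = (-1)^(kl) ψ* ⊗ φ*` in degrees
`k, l`, and `ω_a* = - ω_(bar a)`. -/
def tstar (q : Param) (ξ : Tens q) : Tens q :=
  (star ξ.1,
   fun a => -tau q a (star (ξ.2.1 (bar a))),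
   fun a b => -tau q a (tau q b (star (ξ.2.2.1 (bar b) (bar a)))),
   fun a b c => tau q a (tau q b (tau q c (star (ξ.2.2.2 (bar c) (bar b) (bar a))))))

/-- The wedge product, induced by the tensor product. -/
def wedge (q : Param) (φ ψ : Ext q) : Ext q := toExt q (tmul q (rep q φ) (rep q ψ))

/-- The hermitian conjugation of exterior forms. -/
def estar (q : Param) (φ : Ext q) : Ext q := toExt q (tstar q (rep q φ))

theorem sig_apply (q : Param) (ξ : G2 q) (c d : Idx) :
    sig q ξ c d = ∑ a, ∑ b, braid q a b c d • ξ a b := rfl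

theorem sig_cases (q : Param) (ξ : G2 q) :
    sig q ξ .minus .minus = ξ .minus .minus ∧
    sig q ξ .plus .plus = ξ .plus .plus ∧
    sig q ξ .zed .zed = ξ .zed .zed ∧
    sig q ξ .minus .plus = (1 - cq q ^ 2) • ξ .minus .plus + cq q ^ 4 • ξ .plus .minus ∧
    sig q ξ .plus .minus = (cq q ^ 2)⁻¹ • ξ .minus .plus ∧
    sig q ξ .minus .zed = (1 - cq q ^ 2) • ξ .minus .zed + cq q ^ 6 • ξ .zed .minus ∧
    sig q ξ .zed .minus = (cq q ^ 4)⁻¹ • ξ .minus .zed ∧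
    sig q ξ .zed .plus = (1 - cq q ^ 2) • ξ .zed .plus + cq q ^ 6 • ξ .plus .zed ∧
    sig q ξ .plus .zed = (cq q ^ 4)⁻¹ • ξ .zed .plus := by
  refine ⟨?_, ?_, ?_, ?_, ?_, ?_, ?_, ?_, ?_⟩ <;>
    simp [sig_apply, sum_idx, braid, ee, add_comm]

theorem sig1_apply (q : Param) (ξ : G3 q) (a b c : Idx) :
    sig1 q ξ a b c = sig q (fun a' b' => ξ a' b' c) a b := rfl

theorem sig2_apply (q : Param) (ξ : G3 q) (a b c : Idx) :
    sig2 q ξ a b c = sig q (ξ a) b c := rfl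

/-- The braid relation. -/
theorem sig_braid (q : Param) (ξ : G3 q) :
    sig1 q (sig2 q (sig1 q ξ)) = sig2 q (sig1 q (sig2 q ξ)) := by
  have hq := cq_ne_zero q
  funext a b c
  have h := fun η : G2 q => sig_cases q η
  simp only [sig1_apply, sig2_apply]
  cases a <;> cases b <;> cases c <;>
    simp only [h, sig1_apply, sig2_apply] <;>
    (try (match_scalars <;> field_simp <;> ring))

theorem asym3_eq₁ (q : Param) : ∃ X : Module.End (ASU q) (G3 q), ∀ ξ,
    asym3 q ξ = X (ξ - sig1 q ξ) := by
  refine ⟨1 - (sig2 q : Module.End (ASU q) (G3 q)) + (sig1 q : Module.End (ASU q) (G3 q)) * sig2 q,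
    fun ξ => ?_⟩
  simp only [asym3, Module.End.mul_apply, LinearMap.sub_apply, LinearMap.add_apply,
    Module.End.one_apply, map_sub, map_add, sig_braid]
  abel

theorem asym3_eq₂ (q : Param) : ∃ X : Module.End (ASU q) (G3 q), ∀ ξ,
    asym3 q ξ = X (ξ - sig2 q ξ) := by
  refine ⟨1 - (sig1 q : Module.End (ASU q) (G3 q)) + (sig2 q : Module.End (ASU q) (G3 q)) * sig1 q,
    fun ξ => ?_⟩
  simp only [asym3, Module.End.mul_apply, LinearMap.sub_apply, LinearMap.add_apply,
    Module.End.one_apply, map_sub, map_add]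
  abel

theorem asym2_apply (q : Param) (ξ : G2 q) : asym2 q ξ = ξ - sig q ξ := rfl

theorem asym3_apply (q : Param) (ξ : G3 q) : asym3 q ξ =
    ξ - sig1 q ξ + sig1 q (sig2 q ξ) - sig2 q ξ + sig2 q (sig1 q ξ)
      - sig2 q (sig1 q (sig2 q ξ)) := by
  simp only [asym3, Module.End.mul_apply, LinearMap.sub_apply, LinearMap.add_apply,
    Module.End.one_apply, map_sub, map_add]
  abel

theorem tau_tau (q : Param) (a b : Idx) (x : ASU q) :
    tau q a (tau q b x) = twist q (kap a + kap b) x := twist_twist q _ _ x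

theorem sig_mul_right (q : Param) (ξ : G2 q) (x : ASU q) :
    sig q (fun a b => ξ a b * tau q a (tau q b x)) =
      fun a b => sig q ξ a b * tau q a (tau q b x) := by
  funext a b
  have h := fun η : G2 q => sig_cases q η
  cases a <;> cases b <;>
    simp only [h, tau_tau, kap, add_mul, smul_mul_assoc, Int.reduceAdd]

theorem sig1_mul_right (q : Param) (ξ : G2 q) (f : Idx → ASU q) :
    sig1 q (fun a b c => ξ a b * tau q a (tau q b (f c))) =
      fun a b c => sig q ξ a b * tau q a (tau q b (f c)) := by
  funext a b c
  exact congrFun (congrFun (sig_mul_right q ξ (f c)) a) b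

theorem sig2_mul_left (q : Param) (ω : G1 q) (ξ : G2 q) :
    sig2 q (fun a b c => ω a * tau q a (ξ b c)) = fun a b c => ω a * tau q a (sig q ξ b c) := by
  funext a b c
  simp only [sig2_apply, sig_apply, map_sum, map_smul, Finset.mul_sum, mul_smul_comm]

theorem sig1_mul_right₃ (q : Param) (ξ : G3 q) (x : ASU q) :
    sig1 q (fun a b c => ξ a b c * tau q a (tau q b (tau q c x))) =
      fun a b c => sig1 q ξ a b c * tau q a (tau q b (tau q c x)) := by
  funext a b c
  exact congrFun (congrFun (sig_mul_right q (fun a b => ξ a b c) (tau q c x)) a) b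

theorem sig2_mul_right₃ (q : Param) (ξ : G3 q) (x : ASU q) :
    sig2 q (fun a b c => ξ a b c * tau q a (tau q b (tau q c x))) =
      fun a b c => sig2 q ξ a b c * tau q a (tau q b (tau q c x)) := by
  funext a b c
  simp only [sig2_apply]
  have h := fun η : G2 q => sig_cases q η
  cases b <;> cases c <;>
    simp only [h, tau, twist_twist, kap, add_mul, smul_mul_assoc, Int.reduceAdd]

theorem asym_eq_zero (q : Param) (ξ : Tens q) : asym q ξ = 0 ↔
    ξ.1 = 0 ∧ ξ.2.1 = 0 ∧ asym2 q ξ.2.2.1 = 0 ∧ asym3 q ξ.2.2.2 = 0 := by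
  simp [asym, Prod.ext_iff]

theorem asym3_right (q : Param) (ξ : G3 q) (h : asym3 q ξ = 0) (x : ASU q) :
    asym3 q (fun a b c => ξ a b c * tau q a (tau q b (tau q c x))) = 0 := by
  have := asym3_apply q ξ
  rw [h] at this
  rw [asym3_apply]
  simp only [sig1_mul_right₃, sig2_mul_right₃]
  funext a b c
  have e := congrFun (congrFun (congrFun this a) b) c
  simp only [Pi.add_apply, Pi.sub_apply, Pi.zero_apply, ← add_mul, ← sub_mul] at e ⊢
  rw [← e, zero_mul]

theorem asym_tmul_left (q : Param) (ξ η : Tens q) (h : asym q ξ = 0) :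
    asym q (tmul q ξ η) = 0 := by
  rw [asym_eq_zero] at h ⊢
  obtain ⟨h0, h1, h2, h3⟩ := h
  rw [asym2_apply, sub_eq_zero] at h2
  refine ⟨by simp [tmul, h0], by funext a; simp [tmul, h0, h1], ?_, ?_⟩
  · simp only [tmul, h0, h1, zero_mul, Pi.zero_apply, zero_add]
    rw [asym2_apply, sig_mul_right, ← h2, sub_self]
  · simp only [tmul, h0, h1, zero_mul, Pi.zero_apply, zero_add]
    have e : (fun a b c => ξ.2.2.1 a b * tau q a (tau q b (η.2.1 c)) +
        ξ.2.2.2 a b c * tau q a (tau q b (tau q c η.1))) =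
        (fun a b c => ξ.2.2.1 a b * tau q a (tau q b (η.2.1 c))) +
        (fun a b c => ξ.2.2.2 a b c * tau q a (tau q b (tau q c η.1))) := rfl
    obtain ⟨X, hX⟩ := asym3_eq₁ q
    rw [e, map_add, asym3_right q _ h3, hX, sig1_mul_right, ← h2, sub_self, map_zero, add_zero]

theorem asym_tmul_right (q : Param) (ξ η : Tens q) (h : asym q η = 0) :
    asym q (tmul q ξ η) = 0 := by
  rw [asym_eq_zero] at h ⊢
  obtain ⟨h0, h1, h2, h3⟩ := h
  rw [asym2_apply, sub_eq_zero] at h2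
  refine ⟨by simp [tmul, h0], by funext a; simp [tmul, h0, h1], ?_, ?_⟩
  · simp only [tmul, h0, h1, map_zero, mul_zero, Pi.zero_apply, add_zero]
    have e : (fun a b => ξ.1 * η.2.2.1 a b) = ξ.1 • η.2.2.1 := rfl
    rw [e, map_smul, asym2_apply, ← h2, sub_self, smul_zero]
  · simp only [tmul, h0, h1, map_zero, mul_zero, Pi.zero_apply, add_zero]
    have e : (fun a b c => ξ.1 * η.2.2.2 a b c + ξ.2.1 a * tau q a (η.2.2.1 b c)) =
        ξ.1 • η.2.2.2 + (fun a b c => ξ.2.1 a * tau q a (η.2.2.1 b c)) := rfl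
    obtain ⟨X, hX⟩ := asym3_eq₂ q
    rw [e, map_add, map_smul, h3, hX, sig2_mul_left, ← h2, sub_self, map_zero, add_zero, smul_zero]

theorem tmul_sub_left (q : Param) (ξ ξ' η : Tens q) :
    tmul q (ξ - ξ') η = tmul q ξ η - tmul q ξ' η := by
  simp only [tmul, Prod.ext_iff, Prod.fst_sub, Prod.snd_sub]
  refine ⟨?_, ?_, ?_, ?_⟩ <;> (try funext a) <;> (try funext b) <;> (try funext c) <;>
    simp only [Pi.sub_apply, sub_mul] <;> abel

theorem tmul_sub_right (q : Param) (ξ η η' : Tens q) :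
    tmul q ξ (η - η') = tmul q ξ η - tmul q ξ η' := by
  simp only [tmul, Prod.ext_iff, Prod.fst_sub, Prod.snd_sub]
  refine ⟨?_, ?_, ?_, ?_⟩ <;> (try funext a) <;> (try funext b) <;> (try funext c) <;>
    simp only [Pi.sub_apply, mul_sub, map_sub] <;> abel

/-- The wedge product does not depend on the representing tensors. -/
theorem wedge_toExt (q : Param) (ξ η : Tens q) :
    wedge q (toExt q ξ) (toExt q η) = toExt q (tmul q ξ η) := by
  have h : ∀ ζ : Tens q, asym q (rep q (toExt q ζ) - ζ) = 0 := fun ζ => by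
    rw [map_sub, sub_eq_zero]
    exact congrArg (tens q) (toExt_rep q (toExt q ζ))
  have h1 := asym_tmul_left q _ (rep q (toExt q η)) (h ξ)
  have h2 := asym_tmul_right q ξ _ (h η)
  rw [tmul_sub_left, map_sub, sub_eq_zero] at h1
  rw [tmul_sub_right, map_sub, sub_eq_zero] at h2
  exact tens_injective q (h1.trans h2)

theorem sig_bar (q : Param) (ξ : G2 q) (k : ℤ) :
    (fun a b => twist q (kap a + kap b + k) (star (sig q ξ (bar b) (bar a)))) =
      sig q (fun a b => twist q (kap a + kap b + k) (star (ξ (bar b) (bar a)))) := by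
  have h := fun η : G2 q => sig_cases q η
  have hs : star (cq q) = cq q := conj_cq q
  funext a b
  cases a <;> cases b <;>
    simp only [h, bar, kap, star_add, star_smul, map_add, map_smul, star_sub, star_one, star_pow,
      star_inv₀, hs, Int.reduceAdd]

/-- The involution on threefold tensors. -/
def tstar3 (q : Param) (ξ : G3 q) : G3 q := fun a b c =>
  tau q a (tau q b (tau q c (star (ξ (bar c) (bar b) (bar a)))))

theorem sig1_tstar3 (q : Param) (ξ : G3 q) :
    tstar3 q (sig2 q ξ) = sig1 q (tstar3 q ξ) := by
  funext a b c
  have := congrFun (congrFun (sig_bar q (ξ (bar c)) (kap c)) a) b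
  simp only [tstar3, sig1_apply, sig2_apply, tau, twist_twist, ← add_assoc]
  exact this

theorem sig2_tstar3 (q : Param) (ξ : G3 q) :
    tstar3 q (sig1 q ξ) = sig2 q (tstar3 q ξ) := by
  funext a b c
  have := congrFun (congrFun (sig_bar q (fun b c => ξ b c (bar a)) (kap a)) b) c
  have e : ∀ i j k : ℤ, i + (j + k) = j + k + i := fun i j k => by ring
  have e2 : tstar3 q ξ a = fun b c =>
      twist q (kap b + kap c + kap a) (star (ξ (bar c) (bar b) (bar a))) := by
    funext b c
    simp only [tstar3, tau, twist_twist, e (kap a)]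
  rw [sig2_apply, e2, ← this]
  simp only [tstar3, sig1_apply, tau, twist_twist, e (kap a)]

theorem asym3_tstar3 (q : Param) (ξ : G3 q) (h : asym3 q ξ = 0) : asym3 q (tstar3 q ξ) = 0 := by
  have h0 := asym3_apply q ξ
  rw [h] at h0
  rw [asym3_apply]
  simp only [← sig1_tstar3, ← sig2_tstar3]
  rw [← sig_braid] at h0
  funext a b c
  have e := congrArg (fun x => tau q a (tau q b (tau q c (star x))))
    (congrFun (congrFun (congrFun h0 (bar c)) (bar b)) (bar a))
  simp only [Pi.add_apply, Pi.sub_apply, Pi.zero_apply, star_add, star_sub, map_add, map_sub,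
    star_zero, map_zero] at e
  simp only [Pi.add_apply, Pi.sub_apply, Pi.zero_apply, tstar3]
  rw [e]
  abel

theorem asym_tstar (q : Param) (ξ : Tens q) (h : asym q ξ = 0) : asym q (tstar q ξ) = 0 := by
  rw [asym_eq_zero] at h ⊢
  obtain ⟨h0, h1, h2, h3⟩ := h
  rw [asym2_apply, sub_eq_zero] at h2
  refine ⟨by simp [tstar, h0], by funext a; simp [tstar, h1], ?_, asym3_tstar3 q _ h3⟩
  have e := sig_bar q ξ.2.2.1 0
  rw [← h2] at e
  simp only [add_zero] at e
  have e2 : (tstar q ξ).2.2.1 = -(fun a b => twist q (kap a + kap b)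
      (star (ξ.2.2.1 (bar b) (bar a)))) := by
    funext a b
    simp only [tstar, tau_tau]; rfl
  rw [e2, asym2_apply, map_neg, ← e, sub_self]

theorem tstar_sub (q : Param) (ξ η : Tens q) : tstar q (ξ - η) = tstar q ξ - tstar q η := by
  simp only [tstar, Prod.ext_iff, Prod.fst_sub, Prod.snd_sub]
  refine ⟨?_, ?_, ?_, ?_⟩ <;> (try funext a) <;> (try funext b) <;> (try funext c) <;>
    simp only [Pi.sub_apply, star_sub, map_sub] <;> abel

/-- The conjugation does not depend on the representing tensor. -/
theorem estar_toExt (q : Param) (ξ : Tens q) : estar q (toExt q ξ) = toExt q (tstar q ξ) := by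
  have h : asym q (rep q (toExt q ξ) - ξ) = 0 := by
    rw [map_sub, sub_eq_zero]
    exact congrArg (tens q) (toExt_rep q (toExt q ξ))
  have h1 := asym_tstar q _ h
  rw [tstar_sub, map_sub, sub_eq_zero] at h1
  exact tens_injective q h1

/-! ### Contractions, scalar products, dual operators -/

/-- The component of degree `k` of a tensor. -/
def degPart (q : Param) (k : ℕ) (ξ : Tens q) : Tens q :=
  (if k = 0 then ξ.1 else 0, if k = 1 then ξ.2.1 else 0, if k = 2 then ξ.2.2.1 else 0,
    if k = 3 then ξ.2.2.2 else 0)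

/-- The form `φ` is homogeneous of degree `k`. -/
def IsHomog (q : Param) (k : ℕ) (φ : Ext q) : Prop := degPart q k (tens q φ) = tens q φ

/-- The unit of the exterior algebra. -/
def oneE (q : Param) : Ext q := toExt q (1, 0, 0, 0)

/-- The one-form `ω_a`. -/
def om (q : Param) (a : Idx) : Ext q := toExt q (0, Pi.single a 1, 0, 0)

/-- The two-form `ω₋ ∧ ω₊`. -/
def omMP (q : Param) : Ext q := wedge q (om q .minus) (om q .plus)

/-- The top form `θ = ω₋ ∧ ω₊ ∧ ω_z`. -/
def theta (q : Param) : Ext q := wedge q (omMP q) (om q .zed)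

/-- The eigenvalue `λ₂` of the antisymmetriser. -/
def lam2 (q : Param) : ℂ := 1 + cq q ^ 2

/-- The eigenvalue `λ₃` of the antisymmetriser. -/
def lam3 (q : Param) : ℂ := 1 + 2 * cq q ^ 2 + 2 * cq q ^ 4 + cq q ^ 6

/-- The left invariant scalar product `⟨x ω, x' ω'⟩ = h(x* x') λ_k⁻¹ g(ω*, ω')` attached to the
contraction with components `g a b = g(ω_a, ω_b)`. Forms of degree `k` are antisymmetric tensors,
on which the contraction is the restriction of
`g(ω_a ⊗ ω_b ⊗ ⋯, ω_c ⊗ ω_d ⊗ ⋯) = g(ω_a, ω_c) g(ω_b, ω_d) ⋯`, and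
`(ω_a)* = -ω_(bar a)`, `(ω_a ⊗ ω_b)* = -ω_(bar b) ⊗ ω_(bar a)`,
`(ω_a ⊗ ω_b ⊗ ω_c)* = ω_(bar c) ⊗ ω_(bar b) ⊗ ω_(bar a)`. -/
def scalarProd (q : Param) (g : Matrix Idx Idx ℂ) (φ ψ : Ext q) : ℂ :=
  haar q (star (tens q φ).1 * (tens q ψ).1)
  + ∑ a, ∑ b, haar q (star ((tens q φ).2.1 a) * (tens q ψ).2.1 b) * (-g (bar a) b)
  + (lam2 q)⁻¹ * ∑ a, ∑ b, ∑ c, ∑ d,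
      haar q (star ((tens q φ).2.2.1 a b) * (tens q ψ).2.2.1 c d) * (-(g (bar b) c * g (bar a) d))
  + (lam3 q)⁻¹ * ∑ a, ∑ b, ∑ c, ∑ d, ∑ e, ∑ f,
      haar q (star ((tens q φ).2.2.2 a b c) * (tens q ψ).2.2.2 d e f) *
        (g (bar c) d * g (bar b) e * g (bar a) f)

/-- The integral `∫_μ (x μ) = h(x)` with respect to a volume form `μ` of degree `N`; forms of
degree different from `N` integrate to zero. -/
def integral (q : Param) (N : ℕ) (μ φ : Ext q) : ℂ :=
  haar q (Classical.epsilon fun x : ASU q => degPart q N (tens q φ) = tens q (x • μ))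

/-- `T : Γ^∧k → Γ^∧(3-k)` is the dual operator for `g` and the volume form `μ = m θ`:
`⟨φ, φ'⟩ = ∫_μ φ* ∧ T(φ')`. -/
def IsDualSU (q : Param) (g : Matrix Idx Idx ℂ) (m : ℝ) (T : Ext q →ₗ[ASU q] Ext q) : Prop :=
  (∀ k ≤ 3, ∀ φ : Ext q, IsHomog q k φ → IsHomog q (3 - k) (T φ)) ∧
  ∀ φ ψ : Ext q,
    scalarProd q g φ ψ = integral q 3 ((m : ℂ) • theta q) (wedge q (estar q φ) (T ψ))

/-- The set `𝔊_σ` of right U(1)-invariant, non degenerate contractions which are symmetric (`T²` is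
constant on one-forms) and real (`T(ω_a*) = T(ω_a)*`), for the dual operator `T` of `g`. -/
def hodgeContractions (q : Param) : Set (Matrix Idx Idx ℂ) :=
  {g | (∀ a b, charge a + charge b ≠ 0 → g a b = 0) ∧ g.det ≠ 0 ∧
    ∃ (m : ℝ) (T : Ext q →ₗ[ASU q] Ext q), m ≠ 0 ∧ IsDualSU q g m T ∧
      (∃ ζ : ℂ, ∀ φ : Ext q, IsHomog q 1 φ → T (T φ) = ζ • φ) ∧
      (∀ a, T (estar q (om q a)) = estar q (T (om q a)))}

/-! ### The Podleś sphere -/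

/-- The exterior algebra
`Ω(S²_q) = A(S²_q) ⊕ (L₋₂ ω₋ ⊕ L₂ ω₊) ⊕ A(S²_q) ω₋ ∧ ω₊` inside that of quantum SU(2). -/
def Omega (q : Param) : Submodule (sphere q) (Ext q) where
  carrier := {φ | ∃ f ∈ sphere q, ∃ v ∈ line q (-2), ∃ w ∈ line q 2, ∃ k ∈ sphere q,
    φ = f • oneE q + (v • om q .minus + w • om q .plus) + k • omMP q}
  add_mem' := by
    rintro _ _ ⟨f, hf, v, hv, w, hw, k, hk, rfl⟩ ⟨f', hf', v', hv', w', hw', k', hk', rfl⟩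
    refine ⟨f + f', add_mem hf hf', v + v', add_mem hv hv', w + w', add_mem hw hw', k + k',
      add_mem hk hk', ?_⟩
    simp only [add_smul]
    abel
  zero_mem' := ⟨0, zero_mem _, 0, zero_mem _, 0, zero_mem _, 0, zero_mem _, by simp⟩
  smul_mem' := by
    intro x φ hφ
    obtain ⟨f, hf, v, hv, w, hw, k, hk, h⟩ := hφ
    have hx : (x : ASU q) ∈ line q 0 := (mem_sphere q _).1 x.2
    have hv' := mul_mem_line q hx hv
    have hw' := mul_mem_line q hx hw
    rw [zero_add] at hv' hw'
    refine ⟨x * f, mul_mem x.2 hf, x * v, hv', x * w, hw', x * k, mul_mem x.2 hk, ?_⟩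
    have e : x • φ = (x : ASU q) • φ := rfl
    rw [e, h, smul_add, smul_add, smul_add, smul_smul, smul_smul, smul_smul, smul_smul]

/-- `f ∈ Ω⁰(S²_q)`. -/
def form0 (q : Param) (f : sphere q) : Omega q :=
  ⟨(f : ASU q) • oneE q, f, f.2, 0, zero_mem _, 0, zero_mem _, 0, zero_mem _, by simp⟩

/-- `v ω₋ ∈ Ω¹(S²_q)` for `v ∈ L₋₂`. -/
def formMinus (q : Param) (v : line q (-2)) : Omega q :=
  ⟨(v : ASU q) • om q .minus, 0, zero_mem _, v, v.2, 0, zero_mem _, 0, zero_mem _, by simp⟩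

/-- `v ω₊ ∈ Ω¹(S²_q)` for `v ∈ L₂`. -/
def formPlus (q : Param) (v : line q 2) : Omega q :=
  ⟨(v : ASU q) • om q .plus, 0, zero_mem _, 0, zero_mem _, v, v.2, 0, zero_mem _, by simp⟩

/-- `f ω₋ ∧ ω₊ ∈ Ω²(S²_q)`. -/
def form2 (q : Param) (f : sphere q) : Omega q :=
  ⟨(f : ASU q) • omMP q, 0, zero_mem _, 0, zero_mem _, 0, zero_mem _, f, f.2, by simp⟩

/-- The map `F` is a dual operator on the sphere for `g` and the volume form
`μ̌ = i m ω₋ ∧ ω₊`: `⟨ψ, ψ'⟩ = ∫_μ̌ ψ* ∧ F(ψ')` for all forms on the sphere, with the scalar product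
of quantum SU(2). -/
def IsDualSphere (q : Param) (g : Matrix Idx Idx ℂ) (m : ℝ) (F : Omega q → Omega q) : Prop :=
  ∀ ψ ψ' : Omega q, scalarProd q g ψ ψ' =
    integral q 2 ((Complex.I * m) • omMP q) (wedge q (estar q ψ) (F ψ'))

end

end PodlesHodge

open PodlesHodge

/-!
The proof rests on three facts.

*The Haar state.* It exists because every element of `A(SU_q(2))` is a combination of coefficients
of finite-dimensional unitary corepresentations (`exists_isUnitaryCorep`), and because `1` is not a
combination of slices `(id ⊗ f) Δ(x)` with `f(1) = 0` (`one_notMem_sliceSpan`): in the Hilbert space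
of coefficient matrices the coefficient `1` has a component orthogonal to all linear relations; this
component is invariant, hence orthogonal to all those slices. A functional separating `1` from the
slices is right invariant; transposing the fundamental corepresentation turns it into a left
invariant one, and the two coincide (`isHaarState_haar`). The form `h(x y)` is nondegenerate
(`haar_nondegenerate`): its radical is a left ideal and a right subcomodule, so by the antipode
identity `S'(y₂) y₁ = ε(y)` the counit vanishes on it, and then `y = ε(y₁) y₂ = 0` for all its `y`. As `h` is
invariant under U(1), the pairing `h(x* y)` is nondegenerate on each line bundle.

*The contractions.* In degree three the antisymmetriser has rank one (`asym3_eq`), so the integral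
against `m θ` of a product of forms is an explicit combination of values of `h`. Nondegeneracy then
forces the values of a dual operator on one-forms and two-forms (`IsDualSU.apply_oneForm`,
`IsDualSU.apply_twoForm`). Its square multiplies `ω₊` and `ω_z` by `-2 m² α² γ q⁶ / λ₂` and
`-2 m² α β γ / λ₂`; symmetry therefore gives `β = q⁶ α`, and reality at `ω₋` gives `conj β = q⁶ α`,
so that `α` is real (`hodgeContractions_spec`).

*The sphere.* A form on the sphere has four coefficients, one for each of `1`, `ω₋`, `ω₊` and
`ω₋ ∧ ω₊`. In these coordinates both sides of the duality are diagonal or antidiagonal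
(`scalarProd_sphereForm`, `integral_sphereForm`), which yields the dual operator, and nondegeneracy
on the line bundles yields its uniqueness. On one-forms its square has the eigenvalues
`-q⁻⁴ m² β²` and `-m² α²`, whose ratio is `q⁸ ≠ 1`.
-/

set_option linter.unusedSimpArgs false

namespace PodlesHodge

open scoped TensorProduct LaurentPolynomial

noncomputable section

/-! ### Counit, antipode and transposition -/

/-- The defining relations, oriented as rewriting rules that move `c*` and `c` to the left. -/
theorem relations (q : Param) :
    gen q .a * gen q .as = 1 - cq q ^ 2 • (gen q .cs * gen q .c) ∧
    gen q .as * gen q .a = 1 - gen q .cs * gen q .c ∧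
    gen q .c * gen q .cs = gen q .cs * gen q .c ∧
    gen q .a * gen q .c = cq q • (gen q .c * gen q .a) ∧
    gen q .a * gen q .cs = cq q • (gen q .cs * gen q .a) ∧
    gen q .as * gen q .c = (cq q)⁻¹ • (gen q .c * gen q .as) ∧
    gen q .as * gen q .cs = (cq q)⁻¹ • (gen q .cs * gen q .as) := by
  have hq := cq_ne_zero q
  have h := fun i j => congrFun (congrFun (matU_mul_matUstar q) i) j
  have k := fun i j => congrFun (congrFun (matUstar_mul_matU q) i) j
  have h00 := h 0 0
  have h01 := h 0 1
  have h10 := h 1 0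
  have h11 := h 1 1
  have k00 := k 0 0
  have k01 := k 0 1
  have k10 := k 1 0
  simp only [matU, matUstar, Matrix.mul_fin_two, Matrix.one_fin_two] at h00 h01 h10 h11 k00 k01 k10
  simp [smul_smul, ← sq] at h00 h01 h10 h11 k00 k01 k10
  rw [← sub_eq_add_neg, sub_eq_zero] at h01 h10
  rw [neg_add_eq_sub, sub_eq_zero] at k01 k10
  refine ⟨eq_sub_of_add_eq h00, eq_sub_of_add_eq k00, ?_, k10, h01, ?_, ?_⟩
  · rw [← k00, add_comm] at h11
    exact add_left_cancel h11
  · rw [h10, smul_smul, inv_mul_cancel₀ hq, one_smul]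
  · rw [k01, smul_smul, inv_mul_cancel₀ hq, one_smul]

/-- The counit: the value at the neutral element `z = 1` of the classical subgroup U(1). -/
def counit (q : Param) : ASU q →ₐ[ℂ] ℂ := (evalU1 q 0).comp (proj q)

theorem counit_gen (q : Param) (x : Gen) : counit q (gen q x) =
    match x with
    | .a => 1
    | .as => 1
    | .c => 0
    | .cs => 0 := by
  cases x <;> simp [counit, proj, genProj, evalU1_T]

instance (q : Param) : Nontrivial (ASU q) :=
  (counit q).toRingHom.domain_nontrivial

theorem comul_gen (q : Param) (x : Gen) : comul q (gen q x) = genComul q x := by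
  simp [comul]

theorem counit_comul (q : Param) (x : ASU q) :
    TensorProduct.lid ℂ (ASU q) (TensorProduct.map (counit q).toLinearMap LinearMap.id
      (comul q x)) = x := by
  have : ((Algebra.TensorProduct.lid ℂ (ASU q)).toAlgHom.comp
      ((Algebra.TensorProduct.map (counit q) (AlgHom.id ℂ (ASU q))).comp (comul q)))
        = AlgHom.id ℂ _ := by
    refine ASU_hom_ext q fun x => ?_
    cases x <;> simp [comul_gen, genComul, counit_gen]
  exact DFunLike.congr_fun this x

theorem comul_counit (q : Param) (x : ASU q) :
    TensorProduct.rid ℂ (ASU q) (TensorProduct.map LinearMap.id (counit q).toLinearMap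
      (comul q x)) = x := by
  have : ((Algebra.TensorProduct.rid ℂ ℂ (ASU q)).toAlgHom.comp
      ((Algebra.TensorProduct.map (AlgHom.id ℂ (ASU q)) (counit q)).comp (comul q)))
        = AlgHom.id ℂ _ := by
    refine ASU_hom_ext q fun x => ?_
    cases x <;> simp [comul_gen, genComul, counit_gen]
  exact DFunLike.congr_fun this x

/-- The inverse antipode on the generators. -/
def genAntipodeInv (q : Param) : Gen → (ASU q)ᵐᵒᵖ
  | .a => MulOpposite.op (gen q .as)
  | .as => MulOpposite.op (gen q .a)
  | .c => MulOpposite.op (-((cq q)⁻¹ • gen q .c))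
  | .cs => MulOpposite.op (-(cq q • gen q .cs))

/-- The inverse of the antipode, the antiautomorphism with `S'(y₂) y₁ = ε(y)`. -/
def antipodeInv (q : Param) : ASU q →ₐ[ℂ] (ASU q)ᵐᵒᵖ :=
  liftASU q (genAntipodeInv q)
    (by
      obtain ⟨h1, h2, h3, h4, h5, h6, h7⟩ := relations q
      have hq := cq_ne_zero q
      rw [matU, matUstar, Matrix.mul_fin_two, Matrix.one_fin_two]
      simp only [genAntipodeInv, ← MulOpposite.op_mul, ← MulOpposite.op_smul, ← MulOpposite.op_neg,
        ← MulOpposite.op_add, ← MulOpposite.op_one, ← MulOpposite.op_zero]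
      simp only [mul_neg, neg_mul, neg_neg, smul_neg, mul_smul_comm, smul_mul_assoc, h1, h2, h3, h4,
        h5, h6, h7]
      congr! <;> match_scalars <;> field_simp <;> ring)
    (by
      obtain ⟨h1, h2, h3, h4, h5, h6, h7⟩ := relations q
      have hq := cq_ne_zero q
      rw [matU, matUstar, Matrix.mul_fin_two, Matrix.one_fin_two]
      simp only [genAntipodeInv, ← MulOpposite.op_mul, ← MulOpposite.op_smul, ← MulOpposite.op_neg,
        ← MulOpposite.op_add, ← MulOpposite.op_one, ← MulOpposite.op_zero]
      simp only [mul_neg, neg_mul, neg_neg, smul_neg, mul_smul_comm, smul_mul_assoc, h1, h2, h3, h4,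
        h5, h6, h7]
      congr! <;> match_scalars <;> field_simp <;> ring)

theorem antipodeInv_gen (q : Param) (x : Gen) :
    antipodeInv q (gen q x) = genAntipodeInv q x := by
  simp [antipodeInv]

/-- The linear map `p ⊗ r ↦ S'(r) p`. -/
def antipodeMul (q : Param) : ASU q ⊗[ℂ] ASU q →ₗ[ℂ] ASU q :=
  LinearMap.mul' ℂ (ASU q) ∘ₗ TensorProduct.map
    ((MulOpposite.opLinearEquiv ℂ).symm.toLinearMap ∘ₗ (antipodeInv q).toLinearMap)
    LinearMap.id ∘ₗ (TensorProduct.comm ℂ (ASU q) (ASU q)).toLinearMap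

theorem antipodeMul_tmul (q : Param) (p r : ASU q) :
    antipodeMul q (p ⊗ₜ r) = (antipodeInv q r).unop * p := rfl

/-- Multiplicativity step for `S'(y₂) y₁ = ε(y)`: if the identity holds for `s`, then the factor
`s` can be pulled out of a product as a scalar. -/
theorem antipodeMul_mul_tmul (q : Param) (s : ASU q ⊗[ℂ] ASU q) (p r : ASU q) :
    antipodeMul q (s * p ⊗ₜ r) = (antipodeInv q r).unop * antipodeMul q s * p := by
  induction s with
  | zero => simp
  | tmul p' r' =>
    simp [Algebra.TensorProduct.tmul_mul_tmul, antipodeMul_tmul, mul_assoc]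
  | add s t hs ht => simp [add_mul, mul_add, hs, ht]

theorem antipodeMul_mul (q : Param) (s t : ASU q ⊗[ℂ] ASU q) (c : ℂ)
    (h : antipodeMul q s = algebraMap ℂ _ c) :
    antipodeMul q (s * t) = c • antipodeMul q t := by
  induction t with
  | zero => simp
  | tmul p r =>
    rw [antipodeMul_mul_tmul, h, antipodeMul_tmul, ← Algebra.commutes, mul_assoc,
      Algebra.smul_def]
  | add s t hs ht => simp [mul_add, hs, ht]

/-- The antipode identity `S'(y₂) y₁ = ε(y)`. -/
theorem antipodeMul_comul (q : Param) (y : ASU q) :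
    antipodeMul q (comul q y) = algebraMap ℂ _ (counit q y) := by
  obtain ⟨h1, h2, h3, h4, h5, h6, h7⟩ := relations q
  have hq := cq_ne_zero q
  induction y using ASU_induction with
  | algebraMap r =>
    rw [AlgHom.commutes, AlgHom.commutes, Algebra.TensorProduct.algebraMap_apply,
      antipodeMul_tmul]
    simp
  | gen x =>
    cases x <;> simp [comul_gen, genComul, counit_gen, antipodeMul_tmul, antipodeInv_gen,
      genAntipodeInv, smul_smul, hq, ← sq, h1, h2, h3, h4, h5, h6, h7]
  | mul x y hx hy => rw [map_mul, antipodeMul_mul q _ _ _ hx, hy, map_mul, map_mul,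
      Algebra.smul_def]
  | add x y hx hy => rw [map_add, map_add, map_add, map_add, hx, hy]

/-- The transposition on the generators. -/
def genTransp (q : Param) : Gen → ASU q
  | .a => gen q .a
  | .as => gen q .as
  | .c => -(cq q • gen q .cs)
  | .cs => -((cq q)⁻¹ • gen q .c)

/-- The automorphism `u_ij ↦ u_ji`, which reverses the coproduct. -/
def transp (q : Param) : ASU q →ₐ[ℂ] ASU q :=
  liftASU q (genTransp q)
    (by
      obtain ⟨h1, h2, h3, h4, h5, h6, h7⟩ := relations q
      have hq := cq_ne_zero q
      rw [matU, matUstar, Matrix.mul_fin_two, Matrix.one_fin_two]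
      simp only [genTransp]
      simp only [mul_neg, neg_mul, neg_neg, smul_neg, mul_smul_comm, smul_mul_assoc, h1, h2, h3, h4,
        h5, h6, h7]
      congr! <;> match_scalars <;> field_simp <;> ring)
    (by
      obtain ⟨h1, h2, h3, h4, h5, h6, h7⟩ := relations q
      have hq := cq_ne_zero q
      rw [matU, matUstar, Matrix.mul_fin_two, Matrix.one_fin_two]
      simp only [genTransp]
      simp only [mul_neg, neg_mul, neg_neg, smul_neg, mul_smul_comm, smul_mul_assoc, h1, h2, h3, h4,
        h5, h6, h7]
      congr! <;> match_scalars <;> field_simp <;> ring)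

theorem transp_gen (q : Param) (x : Gen) : transp q (gen q x) = genTransp q x := by
  simp [transp]

theorem transp_transp (q : Param) (x : ASU q) : transp q (transp q x) = x := by
  have : (transp q).comp (transp q) = AlgHom.id ℂ _ := by
    refine ASU_hom_ext q fun x => ?_
    cases x <;> simp [transp_gen, genTransp, smul_smul, cq_ne_zero]
  exact DFunLike.congr_fun this x

theorem comul_transp (q : Param) (x : ASU q) : comul q (transp q x) =
    Algebra.TensorProduct.map (transp q) (transp q)
      (Algebra.TensorProduct.comm ℂ (ASU q) (ASU q) (comul q x)) := by
  have hq := cq_ne_zero q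
  have : (comul q).comp (transp q) = (Algebra.TensorProduct.map (transp q) (transp q)).comp
      ((Algebra.TensorProduct.comm ℂ (ASU q) (ASU q)).toAlgHom.comp (comul q)) := by
    refine ASU_hom_ext q fun x => ?_
    cases x <;> simp [transp_gen, genTransp, comul_gen, genComul, smul_smul, hq,
      TensorProduct.neg_tmul, TensorProduct.tmul_neg, TensorProduct.smul_tmul',
      TensorProduct.tmul_smul, smul_add, add_comm]
  exact DFunLike.congr_fun this x

/-- The antilinear automorphism `u_ij ↦ u_ji`. -/
def kappa (q : Param) (x : ASU q) : ASU q := (antipodeInv q (star x)).unop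

theorem kappa_mul (q : Param) (x y : ASU q) : kappa q (x * y) = kappa q x * kappa q y := by
  simp [kappa]

theorem kappa_one (q : Param) : kappa q 1 = 1 := by
  simp [kappa]

theorem kappa_zero (q : Param) : kappa q 0 = 0 := by
  simp [kappa]

theorem kappa_add (q : Param) (x y : ASU q) : kappa q (x + y) = kappa q x + kappa q y := by
  simp [kappa]

theorem kappa_smul (q : Param) (c : ℂ) (x : ASU q) :
    kappa q (c • x) = (starRingEnd ℂ) c • kappa q x := by
  simp [kappa]

/-! ### Unitary corepresentations -/

/-- A matrix over the algebra which is a unitary corepresentation: `Δ U = U ⊗ U`, and the antilinear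
automorphism `S'(x*)` transposes `U`, which says that `U` is unitary. -/
structure IsUnitaryCorep (q : Param) {ι : Type} [Fintype ι] (U : Matrix ι ι (ASU q)) : Prop where
  comul : ∀ i j, comul q (U i j) = ∑ k, U i k ⊗ₜ U k j
  kappa : ∀ i j, kappa q (U i j) = U j i

theorem isUnitaryCorep_one (q : Param) :
    IsUnitaryCorep q (1 : Matrix Unit Unit (ASU q)) where
  comul i j := by simp [Algebra.TensorProduct.one_def]
  kappa i j := by simp [kappa_one]

theorem isUnitaryCorep_matU (q : Param) : IsUnitaryCorep q (matU q (gen q)) where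
  comul i j := by
    fin_cases i <;> fin_cases j <;>
      simp [matU, comul_gen, genComul, TensorProduct.neg_tmul, TensorProduct.tmul_neg,
        TensorProduct.smul_tmul', TensorProduct.tmul_smul, smul_add, sub_eq_add_neg, add_comm]
  kappa i j := by
    have hq := cq_ne_zero q
    fin_cases i <;> fin_cases j <;>
      simp [matU, kappa, star_gen, genStar, ofConjOp, toConjOp, antipodeInv_gen, genAntipodeInv,
        conj_cq, smul_smul, hq]

theorem IsUnitaryCorep.fromBlocks {q : Param} {ι κ : Type} [Fintype ι] [Fintype κ]
    {U : Matrix ι ι (ASU q)} {V : Matrix κ κ (ASU q)}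
    (hU : IsUnitaryCorep q U) (hV : IsUnitaryCorep q V) :
    IsUnitaryCorep q (Matrix.fromBlocks U 0 0 V) where
  comul i j := by
    rcases i with i | i <;> rcases j with j | j <;>
      simp [Fintype.sum_sum_type, hU.comul, hV.comul]
  kappa i j := by
    rcases i with i | i <;> rcases j with j | j <;>
      simp [hU.kappa, hV.kappa, kappa_zero]

theorem IsUnitaryCorep.kronecker {q : Param} {ι κ : Type} [Fintype ι] [Fintype κ]
    {U : Matrix ι ι (ASU q)} {V : Matrix κ κ (ASU q)}
    (hU : IsUnitaryCorep q U) (hV : IsUnitaryCorep q V) :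
    IsUnitaryCorep q (Matrix.of fun (i j : ι × κ) => U i.1 j.1 * V i.2 j.2) where
  comul i j := by
    simp only [Matrix.of_apply, map_mul, hU.comul, hV.comul, Finset.sum_mul_sum,
      Algebra.TensorProduct.tmul_mul_tmul, Fintype.sum_prod_type]
  kappa i j := by
    simp [kappa_mul, hU.kappa, hV.kappa]

/-- The algebra is spanned by the coefficients of unitary corepresentations. -/
theorem exists_isUnitaryCorep (q : Param) (x : ASU q) :
    ∃ (ι : Type) (_ : Fintype ι) (U : Matrix ι ι (ASU q)) (C : ι → ι → ℂ),
      IsUnitaryCorep q U ∧ x = ∑ i, ∑ j, C i j • U i j := by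
  induction x using ASU_induction with
  | algebraMap r =>
    exact ⟨Unit, inferInstance, 1, fun _ _ => r, isUnitaryCorep_one q, by
      simp [Algebra.algebraMap_eq_smul_one]⟩
  | gen x =>
    have hq := cq_ne_zero q
    refine ⟨Fin 2, inferInstance, matU q (gen q), ?_, isUnitaryCorep_matU q, ?_⟩
    · exact match x with
        | .a => !![1, 0; 0, 0]
        | .as => !![0, 0; 0, 1]
        | .c => !![0, 0; 1, 0]
        | .cs => !![0, -(cq q)⁻¹; 0, 0]
    · cases x <;> simp [matU, smul_smul, hq]
  | mul x y hx hy =>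
    obtain ⟨ι, _, U, C, hU, rfl⟩ := hx
    obtain ⟨κ, _, V, D, hV, rfl⟩ := hy
    refine ⟨ι × κ, inferInstance, _, fun i j => C i.1 j.1 * D i.2 j.2, hU.kronecker hV, ?_⟩
    simp only [Finset.sum_mul_sum, Fintype.sum_prod_type, Matrix.of_apply, smul_mul_smul_comm]
  | add x y hx hy =>
    obtain ⟨ι, _, U, C, hU, rfl⟩ := hx
    obtain ⟨κ, _, V, D, hV, rfl⟩ := hy
    refine ⟨ι ⊕ κ, inferInstance, _, Sum.elim (fun i => Sum.elim (C i) 0)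
      (fun i => Sum.elim 0 (D i)), hU.fromBlocks hV, ?_⟩
    simp [Fintype.sum_sum_type]

/-! ### The Haar state -/

/-- The slice `x ↦ (id ⊗ f) Δ(x)`. -/
def slice (q : Param) (f : ASU q →ₗ[ℂ] ℂ) : ASU q →ₗ[ℂ] ASU q :=
  (TensorProduct.rid ℂ (ASU q)).toLinearMap ∘ₗ TensorProduct.map LinearMap.id f ∘ₗ
    (comul q).toLinearMap

theorem IsUnitaryCorep.slice {q : Param} {ι : Type} [Fintype ι] {U : Matrix ι ι (ASU q)}
    (hU : IsUnitaryCorep q U) (f : ASU q →ₗ[ℂ] ℂ) (i j : ι) :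
    slice q f (U i j) = ∑ k, f (U k j) • U i k := by
  simp [PodlesHodge.slice, hU.comul]

/-- The slices of functionals vanishing at `1`; the functionals vanishing on it are the right
invariant ones. -/
def sliceSpan (q : Param) : Submodule ℂ (ASU q) :=
  Submodule.span ℂ {y | ∃ (f : ASU q →ₗ[ℂ] ℂ) (x : ASU q), f 1 = 0 ∧ y = slice q f x}

/-- By direct sums, one unitary corepresentation is enough for an element of `sliceSpan`. -/
theorem exists_of_mem_sliceSpan (q : Param) {y : ASU q} (hy : y ∈ sliceSpan q) :
    ∃ (ι : Type) (_ : Fintype ι) (U : Matrix ι ι (ASU q)) (f : ι → ι → (ASU q →ₗ[ℂ] ℂ)),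
      IsUnitaryCorep q U ∧ (∀ i j, f i j 1 = 0) ∧ y = ∑ i, ∑ j, slice q (f i j) (U i j) := by
  induction hy using Submodule.span_induction with
  | mem y hy =>
    obtain ⟨f, x, hf, rfl⟩ := hy
    obtain ⟨ι, _, U, C, hU, rfl⟩ := exists_isUnitaryCorep q x
    refine ⟨ι, inferInstance, U, fun i j => C i j • f, hU, by simp [hf], ?_⟩
    simp only [map_sum, map_smul, hU.slice, LinearMap.smul_apply, smul_assoc, Finset.smul_sum]
  | zero => exact ⟨Unit, inferInstance, 1, 0, isUnitaryCorep_one q, by simp, by simp [slice]⟩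
  | add x y _ _ hx hy =>
    obtain ⟨ι, _, U, f, hU, hf, rfl⟩ := hx
    obtain ⟨κ, _, V, g, hV, hg, rfl⟩ := hy
    refine ⟨ι ⊕ κ, inferInstance, _, Sum.elim (fun i => Sum.elim (f i) 0)
      (fun i => Sum.elim 0 (g i)), hU.fromBlocks hV, ?_, ?_⟩
    · rintro (i | i) (j | j) <;> simp [hf, hg]
    · simp [Fintype.sum_sum_type]
  | smul c x _ hx =>
    obtain ⟨ι, _, U, f, hU, hf, rfl⟩ := hx
    refine ⟨ι, inferInstance, U, fun i j => c • f i j, hU, by simp [hf], ?_⟩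
    simp only [hU.slice, LinearMap.smul_apply, smul_assoc, Finset.smul_sum]

/-- The adjoint `x ↦ conj (f (S'(x*)))` of a functional. -/
def adjFun (q : Param) (f : ASU q →ₗ[ℂ] ℂ) : ASU q →ₗ[ℂ] ℂ where
  toFun x := (starRingEnd ℂ) (f (kappa q x))
  map_add' x y := by simp [kappa_add]
  map_smul' c x := by simp [kappa_smul]

theorem adjFun_one (q : Param) (f : ASU q →ₗ[ℂ] ℂ) (h : f 1 = 0) : adjFun q f 1 = 0 := by
  simp [adjFun, kappa_one, h]

/-- The action of a functional `f` on coefficient matrices, which corresponds to `(id ⊗ f) Δ`. The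
Euclidean space supplies the Hilbert space structure. -/
def coefAct {q : Param} {ι : Type} [Fintype ι] (U : Matrix ι ι (ASU q)) (f : ASU q →ₗ[ℂ] ℂ) :
    EuclideanSpace ℂ (ι × ι) →ₗ[ℂ] EuclideanSpace ℂ (ι × ι) where
  toFun C := WithLp.toLp 2 fun p => ∑ j, f (U p.2 j) * C (p.1, j)
  map_add' C D := by ext p; simp [mul_add, Finset.sum_add_distrib]
  map_smul' c C := by ext p; simp [Finset.mul_sum, mul_left_comm]

theorem coefAct_apply {q : Param} {ι : Type} [Fintype ι] (U : Matrix ι ι (ASU q))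
    (f : ASU q →ₗ[ℂ] ℂ) (C : EuclideanSpace ℂ (ι × ι)) (p : ι × ι) :
    coefAct U f C p = ∑ j, f (U p.2 j) * C (p.1, j) := rfl

/-- The element `∑ C_ij U_ij` with coefficient matrix `C`. -/
def ofCoef {q : Param} {ι : Type} [Fintype ι] (U : Matrix ι ι (ASU q)) :
    EuclideanSpace ℂ (ι × ι) →ₗ[ℂ] ASU q where
  toFun C := ∑ p, C p • U p.1 p.2
  map_add' C D := by simp [add_smul, Finset.sum_add_distrib]
  map_smul' c C := by simp [Finset.smul_sum, smul_smul]

theorem ofCoef_apply {q : Param} {ι : Type} [Fintype ι] (U : Matrix ι ι (ASU q))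
    (C : EuclideanSpace ℂ (ι × ι)) : ofCoef U C = ∑ p, C p • U p.1 p.2 := rfl

/-- In particular the action of a functional preserves the linear relations between the
coefficients. -/
theorem IsUnitaryCorep.ofCoef_coefAct {q : Param} {ι : Type} [Fintype ι]
    {U : Matrix ι ι (ASU q)} (hU : IsUnitaryCorep q U) (f : ASU q →ₗ[ℂ] ℂ)
    (C : EuclideanSpace ℂ (ι × ι)) :
    ofCoef U (coefAct U f C) = PodlesHodge.slice q f (ofCoef U C) := by
  simp only [ofCoef_apply, coefAct_apply, map_sum, map_smul, hU.slice, Fintype.sum_prod_type,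
    Finset.sum_smul, Finset.smul_sum, smul_smul]
  refine Finset.sum_congr rfl fun i _ => ?_
  rw [Finset.sum_comm]
  simp only [mul_comm]

/-- The functionals act on coefficient matrices by a `*`-representation. -/
theorem IsUnitaryCorep.inner_coefAct {q : Param} {ι : Type} [Fintype ι]
    {U : Matrix ι ι (ASU q)} (hU : IsUnitaryCorep q U) (f : ASU q →ₗ[ℂ] ℂ)
    (C D : EuclideanSpace ℂ (ι × ι)) :
    inner ℂ C (coefAct U f D) = inner ℂ (coefAct U (adjFun q f) C) D := by
  simp only [PiLp.inner_apply, RCLike.inner_apply, coefAct_apply, Fintype.sum_prod_type,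
    map_sum, map_mul, adjFun, LinearMap.coe_mk, AddHom.coe_mk, Complex.conj_conj, hU.kappa,
    Finset.sum_mul, Finset.mul_sum]
  refine Finset.sum_congr rfl fun i _ => ?_
  rw [Finset.sum_comm]
  refine Finset.sum_congr rfl fun j _ => Finset.sum_congr rfl fun k _ => ?_
  ring

/-- Complete reducibility separates the trivial corepresentation from the others. -/
theorem one_notMem_sliceSpan (q : Param) : (1 : ASU q) ∉ sliceSpan q := by
  classical
  intro h1
  obtain ⟨κ, _, V, g, hV, hg, hone⟩ := exists_of_mem_sliceSpan q h1
  -- the trivial summand makes `1` a coefficient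
  let U := Matrix.fromBlocks (1 : Matrix Unit Unit (ASU q)) 0 0 V
  have hU : IsUnitaryCorep q U := (isUnitaryCorep_one q).fromBlocks hV
  let e : EuclideanSpace ℂ ((Unit ⊕ κ) × (Unit ⊕ κ)) :=
    EuclideanSpace.single (Sum.inl (), Sum.inl ()) 1
  have he : ofCoef U e = 1 := by
    simp [ofCoef_apply, e, U]
  have hfe : ∀ f : ASU q →ₗ[ℂ] ℂ, f 1 = 0 → coefAct U f e = 0 := by
    intro f hf
    ext ⟨i, j⟩
    rcases j with j | j <;> simp [coefAct_apply, e, U, hf, Fintype.sum_sum_type]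
  -- the component of the trivial coefficient orthogonal to the linear relations
  let I := LinearMap.ker (ofCoef U)
  obtain ⟨z, hz, v, hv, hzv⟩ := I.exists_add_mem_mem_orthogonal e
  have hI : ∀ f : ASU q →ₗ[ℂ] ℂ, ∀ C ∈ I, coefAct U f C ∈ I := by
    intro f C hC
    rw [LinearMap.mem_ker] at hC ⊢
    rw [hU.ofCoef_coefAct, hC, map_zero]
  have hfv : ∀ f : ASU q →ₗ[ℂ] ℂ, f 1 = 0 → coefAct U f v = 0 := by
    intro f hf
    have h := hfe f hf
    rw [hzv, map_add] at h
    -- as `f` kills `e`, the vector `f v` lies in `I` and is also orthogonal to `I`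
    have hmem : coefAct U f v ∈ I := by
      rw [eq_neg_of_add_eq_zero_right h]
      exact neg_mem (hI f z hz)
    rw [← inner_self_eq_zero (𝕜 := ℂ), hU.inner_coefAct]
    exact Submodule.inner_right_of_mem_orthogonal (hI _ _ hmem) hv
  -- a coefficient matrix of `1` by slices, which is orthogonal to `v`
  let D := ∑ i, ∑ j, coefAct U (g i j) (EuclideanSpace.single (Sum.inr i, Sum.inr j) 1)
  have hD : ofCoef U D = 1 := by
    rw [hone]
    simp only [D, map_sum, hU.ofCoef_coefAct]
    refine Finset.sum_congr rfl fun i _ => Finset.sum_congr rfl fun j _ => ?_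
    congr 1
    rw [ofCoef_apply, Finset.sum_eq_single (Sum.inr i, Sum.inr j)]
    · simp [U]
    · intro p _ hp
      simp [hp]
    · simp
  have hvD : inner ℂ v D = 0 := by
    simp only [D, inner_sum]
    refine Finset.sum_eq_zero fun i _ => Finset.sum_eq_zero fun j _ => ?_
    rw [hU.inner_coefAct, hfv _ (adjFun_one q _ (hg i j)), inner_zero_left]
  have heD : e - D ∈ I := by
    rw [LinearMap.mem_ker, map_sub, he, hD, sub_self]
  have hve : inner ℂ v e = 0 := by
    have := Submodule.inner_left_of_mem_orthogonal heD hv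
    rwa [inner_sub_right, hvD, sub_zero] at this
  have hvv : v = 0 := by
    rw [← inner_self_eq_zero (𝕜 := ℂ)]
    rw [hzv, inner_add_right, Submodule.inner_left_of_mem_orthogonal hz hv, zero_add] at hve
    exact hve
  rw [hzv, hvv, add_zero, LinearMap.mem_ker.1 hz] at he
  exact zero_ne_one he

/-- A functional that vanishes on `sliceSpan` but not at `1` is right invariant after
normalisation. -/
theorem exists_right_invariant (q : Param) : ∃ h : ASU q →ₗ[ℂ] ℂ, h 1 = 1 ∧
    ∀ x, TensorProduct.lid ℂ (ASU q) (TensorProduct.map h LinearMap.id (comul q x)) = h x • 1 := by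
  obtain ⟨f, hf1, hf⟩ := Submodule.exists_dual_map_eq_bot_of_notMem (one_notMem_sliceSpan q)
    inferInstance
  have hf' : ∀ y ∈ sliceSpan q, f y = 0 := fun y hy => by
    have : f y ∈ (sliceSpan q).map f := Submodule.mem_map_of_mem hy
    rwa [hf, Submodule.mem_bot] at this
  let h : ASU q →ₗ[ℂ] ℂ := (f 1)⁻¹ • f
  have hh : ∀ y ∈ sliceSpan q, h y = 0 := fun y hy => by simp [h, hf' y hy]
  refine ⟨h, by simp [h, hf1], fun x => ?_⟩
  rw [← sub_eq_zero, ← Module.forall_dual_apply_eq_zero_iff ℂ]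
  intro g
  have hswap : ∀ t : ASU q ⊗[ℂ] ASU q,
      g (TensorProduct.lid ℂ (ASU q) (TensorProduct.map h LinearMap.id t)) =
        h (TensorProduct.rid ℂ (ASU q) (TensorProduct.map LinearMap.id g t)) := by
    intro t
    induction t with
    | zero => simp
    | tmul a b => simp [mul_comm]
    | add s t hs ht => simp only [map_add, hs, ht]
  -- `g - g(1) ε` is the part of `g` that vanishes at `1`
  have hslice : h (slice q (g - g 1 • (counit q).toLinearMap) x) = 0 :=
    hh _ (Submodule.subset_span ⟨_, x, by simp, rfl⟩)
  have hdec : slice q (g - g 1 • (counit q).toLinearMap) x = slice q g x - g 1 • x := by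
    have : ∀ t : ASU q ⊗[ℂ] ASU q,
        TensorProduct.map LinearMap.id (g - g 1 • (counit q).toLinearMap) t =
          TensorProduct.map LinearMap.id g t
            - g 1 • TensorProduct.map LinearMap.id (counit q).toLinearMap t := by
      intro t
      induction t with
      | zero => simp
      | tmul a b => simp [TensorProduct.tmul_sub, ← TensorProduct.tmul_smul]
      | add s t hs ht => simp only [map_add, hs, ht, smul_add]; abel
    change TensorProduct.rid ℂ (ASU q) (TensorProduct.map _ _ (comul q x)) = _
    rw [this, map_sub, map_smul, comul_counit]
    rfl
  rw [map_sub, hswap]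
  change h (slice q g x) - _ = 0
  rw [hdec, map_sub, map_smul] at hslice
  rw [map_smul, smul_eq_mul, mul_comm]
  exact hslice

/-- The Haar state exists. -/
theorem isHaarState_haar (q : Param) : IsHaarState q (haar q) := by
  refine Classical.epsilon_spec (p := IsHaarState q) ?_
  obtain ⟨h, h1, hr⟩ := exists_right_invariant q
  let k : ASU q →ₗ[ℂ] ℂ := h ∘ₗ (transp q).toLinearMap
  have hl : ∀ x, TensorProduct.rid ℂ (ASU q)
      (TensorProduct.map LinearMap.id k (comul q x)) = k x • 1 := by
    intro x
    have hkey : ∀ t : ASU q ⊗[ℂ] ASU q,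
        transp q (TensorProduct.rid ℂ (ASU q) (TensorProduct.map LinearMap.id k t)) =
        TensorProduct.lid ℂ (ASU q) (TensorProduct.map h LinearMap.id
          (Algebra.TensorProduct.map (transp q) (transp q)
            (Algebra.TensorProduct.comm ℂ (ASU q) (ASU q) t))) := by
      intro t
      induction t with
      | zero => simp
      | tmul a b => simp [k]
      | add s t hs ht => simp only [map_add, hs, ht]
    have := hkey (comul q x)
    rw [← comul_transp, hr] at this
    have h2 := congrArg (transp q) this
    rw [transp_transp, map_smul, map_one] at h2
    exact h2
  have k1 : k 1 = 1 := by simp [k, h1]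
  -- a left and a right invariant functional coincide
  have hkh : k = h := by
    ext x
    have e1 := congrArg h (hl x)
    have e2 := congrArg k (hr x)
    have hswap : ∀ t : ASU q ⊗[ℂ] ASU q,
        h (TensorProduct.rid ℂ (ASU q) (TensorProduct.map LinearMap.id k t)) =
        k (TensorProduct.lid ℂ (ASU q) (TensorProduct.map h LinearMap.id t)) := by
      intro t
      induction t with
      | zero => simp
      | tmul a b => simp [mul_comm]
      | add s t hs ht => simp only [map_add, hs, ht]
    rw [hswap, e2] at e1
    simpa [h1, k1] using e1.symm
  exact ⟨h, h1, hkh ▸ hl, hr⟩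

theorem haar_one (q : Param) : haar q 1 = 1 := (isHaarState_haar q).1

theorem haar_right (q : Param) (x : ASU q) : TensorProduct.lid ℂ (ASU q)
    (TensorProduct.map (haar q) LinearMap.id (comul q x)) = haar q x • 1 :=
  (isHaarState_haar q).2.2 x

/-! ### Nondegeneracy of the Haar state -/

/-- Every `x ⊗ 1` is a combination of elements `(1 ⊗ z) Δ(w)`. -/
theorem tmul_one_mem_span (q : Param) (x : ASU q) : x ⊗ₜ[ℂ] (1 : ASU q) ∈
    Submodule.span ℂ {t : ASU q ⊗[ℂ] ASU q | ∃ z w, t = (1 ⊗ₜ z) * comul q w} := by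
  set M := Submodule.span ℂ {t : ASU q ⊗[ℂ] ASU q | ∃ z w, t = (1 ⊗ₜ z) * comul q w}
  have hM : ∀ z w, (1 ⊗ₜ z) * comul q w ∈ M := fun z w => Submodule.subset_span ⟨z, w, rfl⟩
  obtain ⟨h1, h2, h3, h4, h5, h6, h7⟩ := relations q
  have hq := cq_ne_zero q
  induction x using ASU_induction with
  | algebraMap r =>
    have := M.smul_mem r (hM 1 1)
    rwa [map_one, mul_one, TensorProduct.smul_tmul', ← Algebra.algebraMap_eq_smul_one] at this
  | gen x =>
    cases x
    · have e : gen q .a ⊗ₜ[ℂ] (1 : ASU q) = (1 ⊗ₜ gen q .as) * comul q (gen q .a)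
          + (1 ⊗ₜ gen q .c) * comul q (gen q .cs) := by
        simp [comul_gen, genComul, mul_add, mul_sub, h1, h2, h3, h4, h5, h6, h7, smul_smul, hq,
          TensorProduct.tmul_sub, TensorProduct.tmul_smul, smul_sub, smul_add]
        module
      rw [e]
      exact add_mem (hM _ _) (hM _ _)
    · have e : gen q .as ⊗ₜ[ℂ] (1 : ASU q) = (1 ⊗ₜ gen q .a) * comul q (gen q .as)
          + cq q ^ 2 • ((1 ⊗ₜ gen q .cs) * comul q (gen q .c)) := by
        simp [comul_gen, genComul, mul_add, mul_sub, h1, h2, h3, h4, h5, h6, h7, smul_smul, hq,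
          TensorProduct.tmul_sub, TensorProduct.tmul_smul, smul_sub, smul_add]
        match_scalars <;> field_simp <;> ring
      rw [e]
      exact add_mem (hM _ _) (M.smul_mem _ (hM _ _))
    · have e : gen q .c ⊗ₜ[ℂ] (1 : ASU q) = (1 ⊗ₜ gen q .as) * comul q (gen q .c)
          - (cq q)⁻¹ • ((1 ⊗ₜ gen q .c) * comul q (gen q .as)) := by
        simp [comul_gen, genComul, mul_add, mul_sub, h1, h2, h3, h4, h5, h6, h7, smul_smul, hq,
          TensorProduct.tmul_sub, TensorProduct.tmul_smul, smul_sub, smul_add]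
        match_scalars <;> field_simp <;> ring
      rw [e]
      exact sub_mem (hM _ _) (M.smul_mem _ (hM _ _))
    · have e : gen q .cs ⊗ₜ[ℂ] (1 : ASU q) = (1 ⊗ₜ gen q .a) * comul q (gen q .cs)
          - cq q • ((1 ⊗ₜ gen q .cs) * comul q (gen q .a)) := by
        simp [comul_gen, genComul, mul_add, mul_sub, h1, h2, h3, h4, h5, h6, h7, smul_smul, hq,
          TensorProduct.tmul_sub, TensorProduct.tmul_smul, smul_sub, smul_add]
        match_scalars <;> field_simp <;> ring
      rw [e]
      exact sub_mem (hM _ _) (M.smul_mem _ (hM _ _))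
  | mul x y hx hy =>
    have h3 : ∀ z : ASU q, ∀ t ∈ M, (1 ⊗ₜ z) * t ∈ M := by
      intro z t ht
      induction ht using Submodule.span_induction with
      | mem t ht =>
        obtain ⟨z', w, rfl⟩ := ht
        rw [← mul_assoc, Algebra.TensorProduct.tmul_mul_tmul, one_mul]
        exact hM _ _
      | zero => simp
      | add s t _ _ hs ht => rw [mul_add]; exact add_mem hs ht
      | smul c t _ ht => rw [mul_smul_comm]; exact M.smul_mem c ht
    have h4 : ∀ w : ASU q, ∀ t ∈ M, t * comul q w ∈ M := by
      intro w t ht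
      induction ht using Submodule.span_induction with
      | mem t ht =>
        obtain ⟨z', w', rfl⟩ := ht
        rw [mul_assoc, ← map_mul]
        exact hM _ _
      | zero => simp
      | add s t _ _ hs ht => rw [add_mul]; exact add_mem hs ht
      | smul c t _ ht => rw [smul_mul_assoc]; exact M.smul_mem c ht
    have h5 : ∀ t ∈ M, (x ⊗ₜ 1) * t ∈ M := by
      intro t ht
      induction ht using Submodule.span_induction with
      | mem t ht =>
        obtain ⟨z, w, rfl⟩ := ht
        have e : (x ⊗ₜ[ℂ] (1 : ASU q)) * (1 ⊗ₜ z) = (1 ⊗ₜ z) * (x ⊗ₜ[ℂ] (1 : ASU q)) := by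
          simp
        rw [← mul_assoc, e, mul_assoc]
        exact h3 _ _ (h4 _ _ hx)
      | zero => simp
      | add s t _ _ hs ht => rw [mul_add]; exact add_mem hs ht
      | smul c t _ ht => rw [mul_smul_comm]; exact M.smul_mem c ht
    have := h5 _ hy
    rwa [Algebra.TensorProduct.tmul_mul_tmul, one_mul] at this
  | add x y hx hy => rw [TensorProduct.add_tmul]; exact add_mem hx hy

/-- The Haar state is nondegenerate. The `y` with `h(x y) = 0` for all `x` form a left ideal `N`
with `Δ(N) ⊆ N ⊗ A`; so `ε(y) = S'(y₂) y₁` belongs to `N`, whence `ε` vanishes on `N`, and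
`y = ε(y₁) y₂ = 0`. -/
theorem haar_nondegenerate (q : Param) (y : ASU q) (hy : ∀ x, haar q (x * y) = 0) : y = 0 := by
  have hN : ∀ y : ASU q, (∀ x, haar q (x * y) = 0) → ∀ x : ASU q,
      TensorProduct.lid ℂ (ASU q) (TensorProduct.map (haar q) LinearMap.id
        ((x ⊗ₜ 1) * comul q y)) = 0 := by
    intro y hy x
    have hx := tmul_one_mem_span q x
    generalize x ⊗ₜ[ℂ] (1 : ASU q) = s at hx ⊢
    induction hx using Submodule.span_induction with
    | mem t ht =>
      obtain ⟨z, w, rfl⟩ := ht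
      have hz : ∀ t : ASU q ⊗[ℂ] ASU q, TensorProduct.lid ℂ (ASU q)
          (TensorProduct.map (haar q) LinearMap.id ((1 ⊗ₜ z) * t)) =
          z * TensorProduct.lid ℂ (ASU q) (TensorProduct.map (haar q) LinearMap.id t) := by
        intro t
        induction t with
        | zero => simp
        | tmul a b => simp
        | add s t hs ht => simp only [mul_add, map_add, hs, ht]
      rw [mul_assoc, ← map_mul, hz, haar_right, hy, zero_smul, mul_zero]
    | zero => simp
    | add s t _ _ hs ht => rw [add_mul, map_add, map_add, hs, ht, add_zero]
    | smul c t _ ht => rw [smul_mul_assoc, map_smul, map_smul, ht, smul_zero]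
  -- `Δ(N) ⊆ N ⊗ A`, by expanding the right leg in a basis
  let b := Module.Basis.ofVectorSpace ℂ (ASU q)
  have hΔ : ∀ y : ASU q, (∀ x, haar q (x * y) = 0) →
      ∃ n : Module.Basis.ofVectorSpaceIndex ℂ (ASU q) →₀ ASU q,
        (∀ i x, haar q (x * n i) = 0) ∧ comul q y = n.sum fun i m => m ⊗ₜ[ℂ] b i := by
    intro y hy
    obtain ⟨n, hn⟩ := TensorProduct.eq_repr_basis_right b (comul q y)
    refine ⟨n, fun i x => ?_, hn.symm⟩
    have h := hN y hy x
    rw [← hn, Finsupp.sum, Finset.mul_sum, map_sum, map_sum] at h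
    simp only [Algebra.TensorProduct.tmul_mul_tmul, one_mul, TensorProduct.map_tmul,
      LinearMap.id_apply, TensorProduct.lid_tmul] at h
    by_cases hi : i ∈ n.support
    · exact linearIndependent_iff'.1 b.linearIndependent _ _ h i hi
    · rw [Finsupp.notMem_support_iff.1 hi, mul_zero, map_zero]
  have heps : ∀ y : ASU q, (∀ x, haar q (x * y) = 0) → counit q y = 0 := by
    intro y hy
    obtain ⟨n, hn, hy'⟩ := hΔ y hy
    have h := congrArg (haar q) (antipodeMul_comul q y)
    rw [hy', Finsupp.sum, map_sum, map_sum, Algebra.algebraMap_eq_smul_one, map_smul,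
      haar_one] at h
    simp only [antipodeMul_tmul, hn, Finset.sum_const_zero] at h
    simpa using h.symm
  obtain ⟨n, hn, hy'⟩ := hΔ y hy
  have h := counit_comul q y
  rw [hy', Finsupp.sum, map_sum, map_sum] at h
  rw [← h]
  refine Finset.sum_eq_zero fun i _ => ?_
  simp [heps _ (hn i)]

/-! ### The Haar state and the U(1)-grading -/

theorem gen_mem_line (q : Param) (x : Gen) : ∃ n : ℤ, gen q x ∈ line q n ∧
    star (gen q x) ∈ line q (-n) := by
  have ha : gen q .a ∈ line q (-1) := by
    simp [mem_line, coact, comul, genComul, proj, genProj]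
  have has : gen q .as ∈ line q 1 := by
    simp [mem_line, coact, comul, genComul, proj, genProj]
  have hc : gen q .c ∈ line q (-1) := by
    simp [mem_line, coact, comul, genComul, proj, genProj]
  have hcs : gen q .cs ∈ line q 1 := by
    simp [mem_line, coact, comul, genComul, proj, genProj]
  cases x
  · exact ⟨-1, ha, by simpa [star_gen, genStar, ofConjOp, toConjOp] using has⟩
  · exact ⟨1, has, by simpa [star_gen, genStar, ofConjOp, toConjOp] using ha⟩
  · exact ⟨-1, hc, by simpa [star_gen, genStar, ofConjOp, toConjOp] using hcs⟩
  · exact ⟨1, hcs, by simpa [star_gen, genStar, ofConjOp, toConjOp] using hc⟩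

theorem one_mem_line (q : Param) : (1 : ASU q) ∈ line q 0 := (sphere q).one_mem

/-- The elements `x` of `L_n` with `x*` in `L_{-n}`. They are all of `L_n`; having the second condition
at hand avoids the comparison of the coaction with the involution. -/
def starLine (q : Param) (n : ℤ) : Submodule ℂ (ASU q) where
  carrier := {x | x ∈ line q n ∧ star x ∈ line q (-n)}
  add_mem' {x y} hx hy := ⟨add_mem hx.1 hy.1, by rw [star_add]; exact add_mem hx.2 hy.2⟩
  zero_mem' := ⟨zero_mem _, by rw [star_zero]; exact zero_mem _⟩
  smul_mem' r x hx := ⟨(line q n).smul_mem r hx.1, by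
    rw [star_smul]; exact (line q (-n)).smul_mem _ hx.2⟩

/-- The algebra is the sum of its spectral subspaces. -/
theorem mem_iSup_starLine (q : Param) (x : ASU q) : x ∈ ⨆ n, starLine q n := by
  induction x using ASU_induction with
  | algebraMap r =>
    rw [Algebra.algebraMap_eq_smul_one]
    refine Submodule.smul_mem _ r (Submodule.mem_iSup_of_mem 0 ⟨one_mem_line q, ?_⟩)
    rw [star_one, neg_zero]
    exact one_mem_line q
  | gen x =>
    obtain ⟨n, h1, h2⟩ := gen_mem_line q x
    exact Submodule.mem_iSup_of_mem n ⟨h1, h2⟩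
  | mul x y hx hy =>
    induction hx using Submodule.iSup_induction' with
    | mem m x hx =>
      induction hy using Submodule.iSup_induction' with
      | mem n y hy =>
        refine Submodule.mem_iSup_of_mem (m + n) ⟨mul_mem_line q hx.1 hy.1, ?_⟩
        rw [star_mul, neg_add_rev]
        exact mul_mem_line q hy.2 hx.2
      | zero => rw [mul_zero]; exact zero_mem _
      | add y z _ _ hy hz => rw [mul_add]; exact add_mem hy hz
    | zero => rw [zero_mul]; exact zero_mem _
    | add x z _ _ hx hz => rw [add_mul]; exact add_mem hx hz
  | add x y hx hy => exact add_mem hx hy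

/-- The Haar state is invariant under the coaction of U(1). -/
theorem haar_coact (q : Param) (x : ASU q) : TensorProduct.lid ℂ ℂ[T;T⁻¹]
    (TensorProduct.map (haar q) LinearMap.id (coact q x)) = haar q x • 1 := by
  have h : ∀ t : ASU q ⊗[ℂ] ASU q, TensorProduct.lid ℂ ℂ[T;T⁻¹]
      (TensorProduct.map (haar q) LinearMap.id
        (Algebra.TensorProduct.map (AlgHom.id ℂ (ASU q)) (proj q) t)) =
      proj q (TensorProduct.lid ℂ (ASU q) (TensorProduct.map (haar q) LinearMap.id t)) := by
    intro t
    induction t with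
    | zero => simp
    | tmul a b => simp
    | add s t hs ht => simp only [map_add, hs, ht]
  have e := h (comul q x)
  rw [haar_right, map_smul, map_one] at e
  exact e

theorem haar_twist (q : Param) (k : ℤ) (x : ASU q) : haar q (twist q k x) = haar q x := by
  have h : ∀ t : ASU q ⊗[ℂ] ℂ[T;T⁻¹],
      haar q (Algebra.TensorProduct.rid ℂ ℂ (ASU q)
        (Algebra.TensorProduct.map (AlgHom.id ℂ (ASU q)) (evalU1 q k) t)) =
      evalU1 q k (TensorProduct.lid ℂ ℂ[T;T⁻¹] (TensorProduct.map (haar q) LinearMap.id t)) := by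
    intro t
    induction t with
    | zero => simp
    | tmul a b => simp [mul_comm]
    | add s t hs ht => simp only [map_add, hs, ht]
  have e := h (coact q x)
  rw [haar_coact, map_smul, map_one, smul_eq_mul, mul_one] at e
  exact e

theorem haar_of_mem_line (q : Param) {n : ℤ} (hn : n ≠ 0) {x : ASU q} (hx : x ∈ line q n) :
    haar q x = 0 := by
  have h := haar_twist q 1 x
  rw [twist_of_mem_line q _ _ hx, map_smul, smul_eq_mul, one_mul] at h
  by_contra h0
  have h1 : cq q ^ n = 1 := mul_right_cancel₀ h0 (h.trans (one_mul _).symm)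
  have h2 : (q : ℝ) ^ n = 1 := by
    unfold cq at h1
    exact_mod_cast h1
  exact hn ((zpow_eq_one_iff_right₀ q.2.1.le q.2.2.ne).1 h2)

/-- The sesquilinear form `h(x* y)` is nondegenerate on each line bundle: `L_m` and `L_n` are
orthogonal for `m ≠ n`, and the line bundles span the algebra. -/
theorem eq_zero_of_haar_line (q : Param) {n : ℤ} {y : ASU q} (hy : y ∈ line q n)
    (h : ∀ x ∈ line q n, haar q (star x * y) = 0) : y = 0 := by
  refine haar_nondegenerate q y fun x => ?_
  have hx := mem_iSup_starLine q x
  induction hx using Submodule.iSup_induction' with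
  | mem m x hx =>
    by_cases hm : m = -n
    · have := h (star x) (by simpa [hm] using hx.2)
      rwa [star_star] at this
    · exact haar_of_mem_line q (n := m + n) (by omega) (mul_mem_line q hx.1 hy)
  | zero => simp
  | add x z _ _ hx hz => rw [add_mul, map_add, hx, hz, add_zero]

/-! ### Exterior forms on quantum SU(2) in coordinates -/

/-- The coordinate `x` of the exterior form `x θ` of a threefold tensor. -/
def topCoef (q : Param) (ξ : G3 q) : ASU q :=
  ξ .minus .plus .zed - cq q ^ 2 • ξ .plus .minus .zed - (cq q ^ 4)⁻¹ • ξ .minus .zed .plus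
    + ξ .zed .minus .plus + cq q ^ 6 • ξ .plus .zed .minus - cq q ^ 2 • ξ .zed .plus .minus

/-- The components of the antisymmetric tensor `θ`. -/
def thetaTens (q : Param) : Idx → Idx → Idx → ℂ
  | .minus, .plus, .zed => cq q ^ 4
  | .plus, .minus, .zed => -1
  | .minus, .zed, .plus => -cq q ^ 10
  | .zed, .minus, .plus => cq q ^ 4
  | .plus, .zed, .minus => (cq q ^ 6)⁻¹
  | .zed, .plus, .minus => -1
  | _, _, _ => 0

/-- The antisymmetriser in degree three has rank one. -/
theorem asym3_eq (q : Param) (ξ : G3 q) :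
    asym3 q ξ = fun a b c => thetaTens q a b c • topCoef q ξ := by
  have hq := cq_ne_zero q
  have h := fun η : G2 q => sig_cases q η
  funext a b c
  rw [asym3_apply]
  simp only [Pi.add_apply, Pi.sub_apply, sig1_apply, sig2_apply]
  cases a <;> cases b <;> cases c <;>
    simp only [h, sig1_apply, sig2_apply, thetaTens, topCoef] <;>
    (try (match_scalars <;> field_simp <;> ring))

theorem asym2_cases (q : Param) (ξ : G2 q) :
    asym2 q ξ .minus .minus = 0 ∧ asym2 q ξ .plus .plus = 0 ∧ asym2 q ξ .zed .zed = 0 ∧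
    asym2 q ξ .minus .plus = cq q ^ 2 • (ξ .minus .plus - cq q ^ 2 • ξ .plus .minus) ∧
    asym2 q ξ .plus .minus = -(cq q ^ 2)⁻¹ • (ξ .minus .plus - cq q ^ 2 • ξ .plus .minus) ∧
    asym2 q ξ .minus .zed = cq q ^ 2 • (ξ .minus .zed - cq q ^ 4 • ξ .zed .minus) ∧
    asym2 q ξ .zed .minus = -(cq q ^ 4)⁻¹ • (ξ .minus .zed - cq q ^ 4 • ξ .zed .minus) ∧
    asym2 q ξ .zed .plus = cq q ^ 2 • (ξ .zed .plus - cq q ^ 4 • ξ .plus .zed) ∧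
    asym2 q ξ .plus .zed = -(cq q ^ 4)⁻¹ • (ξ .zed .plus - cq q ^ 4 • ξ .plus .zed) := by
  have hq := cq_ne_zero q
  have h := sig_cases q ξ
  simp only [asym2_apply, Pi.sub_apply, h]
  refine ⟨?_, ?_, ?_, ?_, ?_, ?_, ?_, ?_, ?_⟩ <;> (try simp only [sub_self]) <;>
    match_scalars <;> field_simp <;> ring

/-- The tensor `p ω₋ ⊗ ω₊ + r ω₋ ⊗ ω_z + s ω_z ⊗ ω₊`. -/
def twoTens {q : Param} (p r s : ASU q) : G2 q
  | .minus, .plus => p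
  | .minus, .zed => r
  | .zed, .plus => s
  | _, _ => 0

/-- The one-form `∑ x_a ω_a`. -/
def oneForm {q : Param} (x : G1 q) : Ext q := toExt q (0, x, 0, 0)

/-- The two-form `p ω₋ ∧ ω₊ + r ω₋ ∧ ω_z + s ω_z ∧ ω₊`. -/
def twoForm {q : Param} (p r s : ASU q) : Ext q := toExt q (0, 0, twoTens p r s, 0)

theorem tens_toExt_eq (q : Param) (t : Tens q) :
    tens q (toExt q t) = (t.1, t.2.1, asym2 q t.2.2.1, asym3 q t.2.2.2) := rfl

theorem toExt_eq_iff (q : Param) (t t' : Tens q) : toExt q t = toExt q t' ↔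
    t.1 = t'.1 ∧ t.2.1 = t'.2.1 ∧ asym2 q t.2.2.1 = asym2 q t'.2.2.1 ∧
      asym3 q t.2.2.2 = asym3 q t'.2.2.2 := by
  rw [← (tens_injective q).eq_iff, tens_toExt_eq, tens_toExt_eq]
  simp [Prod.ext_iff]

/-- Every antisymmetric tensor of degree two comes from the span of `ω₋ ⊗ ω₊`, `ω₋ ⊗ ω_z` and
`ω_z ⊗ ω₊`. -/
theorem asym2_twoTens (q : Param) (ξ : G2 q) : asym2 q ξ =
    asym2 q (twoTens (ξ .minus .plus - cq q ^ 2 • ξ .plus .minus)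
      (ξ .minus .zed - cq q ^ 4 • ξ .zed .minus) (ξ .zed .plus - cq q ^ 4 • ξ .plus .zed)) := by
  have h := fun η : G2 q => asym2_cases q η
  funext a b
  cases a <;> cases b <;> simp [h, twoTens]

theorem oneForm_injective (q : Param) : Function.Injective (oneForm (q := q)) := by
  intro x y h
  exact ((toExt_eq_iff q _ _).1 h).2.1

theorem twoForm_eq_iff (q : Param) (p r s p' r' s' : ASU q) :
    twoForm p r s = twoForm p' r' s' ↔ p = p' ∧ r = r' ∧ s = s' := by
  refine ⟨fun h => ?_, fun ⟨h1, h2, h3⟩ => by rw [h1, h2, h3]⟩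
  have e := ((toExt_eq_iff q _ _).1 h).2.2.1
  have hc := fun η : G2 q => asym2_cases q η
  have hq := cq_ne_zero q
  have e1 := congrFun (congrFun e .minus) .plus
  have e2 := congrFun (congrFun e .minus) .zed
  have e3 := congrFun (congrFun e .zed) .plus
  simp only [hc, twoTens, smul_zero, sub_zero] at e1 e2 e3
  have h2 := pow_ne_zero 2 hq
  exact ⟨smul_right_injective _ h2 e1, smul_right_injective _ h2 e2, smul_right_injective _ h2 e3⟩

theorem isHomog_oneForm (q : Param) (x : G1 q) : IsHomog q 1 (oneForm x) := by
  simp [IsHomog, oneForm, tens_toExt_eq, degPart]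

theorem isHomog_twoForm (q : Param) (p r s : ASU q) : IsHomog q 2 (twoForm p r s) := by
  simp [IsHomog, twoForm, tens_toExt_eq, degPart]

theorem exists_oneForm (q : Param) {φ : Ext q} (h : IsHomog q 1 φ) : ∃ x, φ = oneForm x := by
  obtain ⟨t, rfl⟩ := toExt_surjective q φ
  simp only [IsHomog, tens_toExt_eq, degPart, Prod.ext_iff] at h
  simp at h
  refine ⟨t.2.1, (toExt_eq_iff q _ _).2 ⟨h.1.symm, rfl, ?_, ?_⟩⟩
  · simpa using h.2.1.symm
  · simpa using h.2.2.symm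

theorem exists_twoForm (q : Param) {φ : Ext q} (h : IsHomog q 2 φ) :
    ∃ p r s, φ = twoForm p r s := by
  obtain ⟨t, rfl⟩ := toExt_surjective q φ
  simp only [IsHomog, tens_toExt_eq, degPart, Prod.ext_iff] at h
  simp at h
  refine ⟨_, _, _, (toExt_eq_iff q _ _).2 ⟨h.1.symm, h.2.1.symm, asym2_twoTens q _, ?_⟩⟩
  simpa using h.2.2.symm

theorem om_eq (q : Param) (a : Idx) : om q a = oneForm (Pi.single a 1) := rfl

theorem estar_oneForm (q : Param) (x : G1 q) :
    estar q (oneForm x) = oneForm fun a => -tau q a (star (x (bar a))) := by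
  rw [oneForm, estar_toExt, oneForm, toExt_eq_iff]
  simp only [tstar, Pi.zero_apply, star_zero, map_zero, neg_zero, true_and]
  exact ⟨map_zero _, map_zero _⟩

theorem omMP_eq (q : Param) : omMP q = twoForm 1 0 0 := by
  rw [omMP, om, om, wedge_toExt, twoForm, toExt_eq_iff]
  refine ⟨by simp [tmul], by funext a; simp [tmul], ?_, ?_⟩
  · congr 1
    funext a b
    cases a <;> cases b <;> simp [tmul, twoTens]
  · congr 1
    funext a b c
    simp [tmul]

theorem theta_eq (q : Param) : ∃ ξ : G3 q, topCoef q ξ = 1 ∧ theta q = toExt q (0, 0, 0, ξ) := by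
  refine ⟨fun a b c => twoTens 1 0 0 a b * (Pi.single Idx.zed 1 : G1 q) c, ?_, ?_⟩
  · simp [topCoef, twoTens]
  · rw [theta, omMP_eq, om, twoForm, wedge_toExt, toExt_eq_iff]
    refine ⟨by simp [tmul], by funext a; simp [tmul], ?_, ?_⟩
    · congr 1
      funext a b
      simp [tmul]
    · congr 1
      funext a b c
      cases c <;> simp [tmul]

theorem topCoef_smul (q : Param) (x : ASU q) (ξ : G3 q) :
    topCoef q (x • ξ) = x * topCoef q ξ := by
  simp [topCoef, mul_add, mul_sub]

theorem integral_three (q : Param) {m : ℂ} (hm : m ≠ 0) (t : Tens q) :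
    integral q 3 (m • theta q) (toExt q t) = m⁻¹ * haar q (topCoef q t.2.2.2) := by
  have hq := cq_ne_zero q
  obtain ⟨ξ, hξ, hθ⟩ := theta_eq q
  have key : ∀ x : ASU q, degPart q 3 (tens q (toExt q t)) = tens q (x • m • theta q) ↔
      x = m⁻¹ • topCoef q t.2.2.2 := by
    intro x
    have e : x • m • theta q = toExt q ((m • x) • (0, 0, 0, ξ)) := by
      rw [hθ, map_smul, smul_assoc, smul_comm]
    rw [e, tens_toExt_eq, tens_toExt_eq]
    simp only [degPart, Prod.ext_iff, Prod.smul_fst, Prod.smul_snd, smul_zero, map_zero, asym3_eq]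
    rw [topCoef_smul, hξ, mul_one]
    constructor
    · rintro ⟨-, -, -, h⟩
      have h1 := congrFun (congrFun (congrFun h .minus) .plus) .zed
      have h2 := smul_right_injective _ (pow_ne_zero 4 hq) h1
      rw [h2, smul_smul, inv_mul_cancel₀ hm, one_smul]
    · rintro rfl
      simp [smul_smul, hm]
  unfold integral
  simp only [key]
  rw [Classical.epsilon_spec (p := fun x => x = m⁻¹ • topCoef q t.2.2.2) ⟨_, rfl⟩, map_smul,
    smul_eq_mul]

/-! ### Hodge contractions -/

theorem smul_oneForm (q : Param) (c : ℂ) (x : G1 q) : c • oneForm x = oneForm (c • x) := by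
  have : (c • (0, x, 0, 0) : Tens q) = (0, c • x, 0, 0) := by simp
  rw [oneForm, oneForm, ← this, LinearMap.map_smul_of_tower]

theorem lam2_ne_zero (q : Param) : lam2 q ≠ 0 := by
  have h : lam2 q = ((1 + (q : ℝ) ^ 2 : ℝ) : ℂ) := by simp [lam2, cq]
  rw [h, Complex.ofReal_ne_zero]
  positivity

theorem contraction_eq_zero {g : Matrix Idx Idx ℂ}
    (hg : ∀ a b, charge a + charge b ≠ 0 → g a b = 0) :
    g .minus .minus = 0 ∧ g .minus .zed = 0 ∧ g .plus .plus = 0 ∧ g .plus .zed = 0 ∧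
      g .zed .minus = 0 ∧ g .zed .plus = 0 := by
  refine ⟨?_, ?_, ?_, ?_, ?_, ?_⟩ <;> exact hg _ _ (by simp [charge])

theorem contraction_ne_zero {g : Matrix Idx Idx ℂ}
    (hg : ∀ a b, charge a + charge b ≠ 0 → g a b = 0) (hdet : g.det ≠ 0) :
    g .minus .plus ≠ 0 ∧ g .plus .minus ≠ 0 ∧ g .zed .zed ≠ 0 := by
  obtain ⟨h1, h2, h3, h4, h5, h6⟩ := contraction_eq_zero hg
  refine ⟨fun h => hdet ?_, fun h => hdet ?_, fun h => hdet ?_⟩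
  · exact Matrix.det_eq_zero_of_row_eq_zero .minus fun b => by cases b <;> assumption
  · exact Matrix.det_eq_zero_of_row_eq_zero .plus fun b => by cases b <;> assumption
  · exact Matrix.det_eq_zero_of_row_eq_zero .zed fun b => by cases b <;> assumption

theorem scalarProd_oneForm (q : Param) {g : Matrix Idx Idx ℂ}
    (hg : ∀ a b, charge a + charge b ≠ 0 → g a b = 0) (x y : G1 q) :
    scalarProd q g (oneForm x) (oneForm y) =
      -(g .plus .minus * haar q (star (x .minus) * y .minus))
      - g .minus .plus * haar q (star (x .plus) * y .plus)
      - g .zed .zed * haar q (star (x .zed) * y .zed) := by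
  obtain ⟨h1, h2, h3, h4, h5, h6⟩ := contraction_eq_zero hg
  simp only [scalarProd, oneForm, tens_toExt_eq, sum_idx, bar, h1, h2, h3, h4, h5, h6, map_zero,
    Pi.zero_apply, mul_zero, zero_mul, add_zero, zero_add, neg_zero, star_zero]
  ring

theorem scalarProd_twoForm (q : Param) {g : Matrix Idx Idx ℂ}
    (hg : ∀ a b, charge a + charge b ≠ 0 → g a b = 0) (p r s p' r' s' : ASU q) :
    scalarProd q g (twoForm p r s) (twoForm p' r' s') = 2 * (lam2 q)⁻¹ *
      (g .minus .plus * g .plus .minus * haar q (star p * p')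
        + (cq q ^ 2)⁻¹ * g .plus .minus * g .zed .zed * haar q (star r * r')
        + (cq q ^ 2)⁻¹ * g .minus .plus * g .zed .zed * haar q (star s * s')) := by
  obtain ⟨h1, h2, h3, h4, h5, h6⟩ := contraction_eq_zero hg
  have hc := fun η : G2 q => asym2_cases q η
  have hs : star (cq q) = cq q := conj_cq q
  have hq := cq_ne_zero q
  simp only [scalarProd, twoForm, tens_toExt_eq, sum_idx, bar, h1, h2, h3, h4, h5, h6, map_zero,
    Pi.zero_apply, mul_zero, zero_mul, add_zero, zero_add, neg_zero, star_zero, hc, twoTens,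
    smul_zero, sub_zero, star_smul, star_neg, star_pow, star_inv₀, hs, smul_mul_smul_comm,
    map_smul, smul_eq_mul, neg_smul, neg_mul, mul_neg, map_neg, neg_neg]
  field_simp
  ring

theorem integral_oneForm_twoForm (q : Param) {m : ℂ} (hm : m ≠ 0) (x : G1 q) (p r s : ASU q) :
    integral q 3 (m • theta q) (wedge q (estar q (oneForm x)) (twoForm p r s)) =
      m⁻¹ * ((cq q ^ 4)⁻¹ * haar q (star (x .plus) * s) + cq q ^ 2 * haar q (star (x .minus) * r)
        - haar q (star (x .zed) * p)) := by
  rw [estar_oneForm, oneForm, twoForm, wedge_toExt, integral_three q hm]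
  simp only [tmul, topCoef, twoTens, bar, zero_mul, mul_zero, map_zero, zero_add, add_zero,
    smul_zero, sub_zero, zero_sub, Pi.zero_apply, neg_mul, mul_neg, smul_neg, neg_neg, map_sub,
    map_add, map_smul, map_neg, ← map_mul, tau, haar_twist, smul_eq_mul]
  ring

/-- The integral over the sphere of a two-form without `ω_z`. -/
theorem integral_twoForm_oneForm (q : Param) {m : ℂ} (hm : m ≠ 0) (y : G1 q) (p r s : ASU q) :
    integral q 3 (m • theta q) (wedge q (estar q (twoForm p r s)) (oneForm y)) =
      m⁻¹ * (cq q ^ 2 * haar q (star r * y .minus) + (cq q ^ 4)⁻¹ * haar q (star s * y .plus)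
        - haar q (star p * y .zed)) := by
  rw [oneForm, twoForm, estar_toExt, wedge_toExt, integral_three q hm]
  simp only [tmul, tstar, topCoef, twoTens, bar, zero_mul, mul_zero, map_zero, zero_add, add_zero,
    smul_zero, sub_zero, zero_sub, Pi.zero_apply, neg_mul, mul_neg, smul_neg, neg_neg, map_sub,
    map_add, map_smul, map_neg, ← map_mul, tau, haar_twist, smul_eq_mul, star_zero, neg_zero]
  ring

theorem eq_of_haar_star_mul (q : Param) {y z : ASU q}
    (h : ∀ x, haar q (star x * y) = haar q (star x * z)) : y = z := by
  rw [← sub_eq_zero]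
  refine haar_nondegenerate q _ fun x => ?_
  have := h (star x)
  rw [star_star] at this
  rw [mul_sub, map_sub, this, sub_self]

/-- The dual operator of a contraction on one-forms. -/
theorem IsDualSU.apply_oneForm {q : Param} {g : Matrix Idx Idx ℂ}
    (hg : ∀ a b, charge a + charge b ≠ 0 → g a b = 0) {m : ℝ} (hm : m ≠ 0)
    {T : Ext q →ₗ[ASU q] Ext q} (hT : IsDualSU q g m T) (y : G1 q) :
    T (oneForm y) = twoForm ((m * g .zed .zed) • y .zed)
      (-(m * g .plus .minus * (cq q ^ 2)⁻¹) • y .minus)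
      (-(m * g .minus .plus * cq q ^ 4) • y .plus) := by
  have hq := cq_ne_zero q
  have hm' : (m : ℂ) ≠ 0 := by exact_mod_cast hm
  obtain ⟨p, r, s, h⟩ := exists_twoForm q (hT.1 1 (by norm_num) _ (isHomog_oneForm q y))
  have key : ∀ x : G1 q, _ := fun x => hT.2 (oneForm x) (oneForm y)
  simp only [h, scalarProd_oneForm q hg, integral_oneForm_twoForm q hm'] at key
  rw [h, twoForm_eq_iff]
  refine ⟨?_, ?_, ?_⟩
  · refine eq_of_haar_star_mul q fun x => ?_
    have := key (Pi.single .zed x)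
    simp at this
    rw [mul_smul_comm, map_smul, smul_eq_mul]
    field_simp at this
    linear_combination -this
  · refine eq_of_haar_star_mul q fun x => ?_
    have := key (Pi.single .minus x)
    simp at this
    rw [mul_smul_comm, map_smul, smul_eq_mul]
    field_simp at this ⊢
    linear_combination -this
  · refine eq_of_haar_star_mul q fun x => ?_
    have := key (Pi.single .plus x)
    simp at this
    rw [mul_smul_comm, map_smul, smul_eq_mul]
    field_simp at this ⊢
    linear_combination -this

/-- The dual operator of a contraction on two-forms. -/
theorem IsDualSU.apply_twoForm {q : Param} {g : Matrix Idx Idx ℂ}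
    (hg : ∀ a b, charge a + charge b ≠ 0 → g a b = 0) {m : ℝ} (hm : m ≠ 0)
    {T : Ext q →ₗ[ASU q] Ext q} (hT : IsDualSU q g m T) (p r s : ASU q) :
    ∃ y : G1 q, T (twoForm p r s) = oneForm y ∧
      y .minus = (2 * (lam2 q)⁻¹ * m * g .plus .minus * g .zed .zed * (cq q ^ 4)⁻¹) • r ∧
      y .plus = (2 * (lam2 q)⁻¹ * m * g .minus .plus * g .zed .zed * cq q ^ 2) • s ∧
      y .zed = -(2 * (lam2 q)⁻¹ * m * g .minus .plus * g .plus .minus) • p := by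
  have hq := cq_ne_zero q
  have hm' : (m : ℂ) ≠ 0 := by exact_mod_cast hm
  obtain ⟨y, h⟩ := exists_oneForm q (hT.1 2 (by norm_num) _ (isHomog_twoForm q p r s))
  have hl := lam2_ne_zero q
  have key := fun p' r' s' => hT.2 (twoForm p' r' s') (twoForm p r s)
  simp only [h, scalarProd_twoForm q hg, integral_twoForm_oneForm q hm'] at key
  refine ⟨y, h, ?_, ?_, ?_⟩
  · refine eq_of_haar_star_mul q fun x => ?_
    have := key 0 x 0
    simp at this
    rw [mul_smul_comm, map_smul, smul_eq_mul]
    field_simp at this ⊢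
    linear_combination -this
  · refine eq_of_haar_star_mul q fun x => ?_
    have := key 0 0 x
    simp at this
    rw [mul_smul_comm, map_smul, smul_eq_mul]
    field_simp at this ⊢
    linear_combination -this
  · refine eq_of_haar_star_mul q fun x => ?_
    have := key x 0 0
    simp at this
    rw [mul_smul_comm, map_smul, smul_eq_mul]
    field_simp at this ⊢
    linear_combination this

/-- Symmetry and reality determine a Hodge contraction up to two real parameters. -/
theorem hodgeContractions_spec (q : Param) {g : Matrix Idx Idx ℂ} (hg : g ∈ hodgeContractions q) :
    (∀ a b, charge a + charge b ≠ 0 → g a b = 0) ∧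
    ∃ α : ℝ, α ≠ 0 ∧ g .minus .plus = α ∧ g .plus .minus = cq q ^ 6 * α := by
  obtain ⟨hc, hdet, m, T, hm, hT, ⟨ζ, hζ⟩, hreal⟩ := hg
  have hq := cq_ne_zero q
  have hm' : (m : ℂ) ≠ 0 := by exact_mod_cast hm
  obtain ⟨hα, hβ, hγ⟩ := contraction_ne_zero hc hdet
  have hl := lam2_ne_zero q
  -- compare the eigenvalues of `T²` at `ω₊` and at `ω_z`
  have hsym : g .plus .minus = cq q ^ 6 * g .minus .plus := by
    have h1 := hζ _ (isHomog_oneForm q (Pi.single .plus 1))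
    have h2 := hζ _ (isHomog_oneForm q (Pi.single .zed 1))
    rw [hT.apply_oneForm hc hm] at h1 h2
    obtain ⟨y, hy, hy1, hy2, hy3⟩ := hT.apply_twoForm hc hm
      ((m * g .zed .zed) • (Pi.single .plus 1 : G1 q) .zed)
      (-(m * g .plus .minus * (cq q ^ 2)⁻¹) • (Pi.single .plus 1 : G1 q) .minus)
      (-(m * g .minus .plus * cq q ^ 4) • (Pi.single .plus 1 : G1 q) .plus)
    obtain ⟨w, hw, hw1, hw2, hw3⟩ := hT.apply_twoForm hc hm
      ((m * g .zed .zed) • (Pi.single .zed 1 : G1 q) .zed)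
      (-(m * g .plus .minus * (cq q ^ 2)⁻¹) • (Pi.single .zed 1 : G1 q) .minus)
      (-(m * g .minus .plus * cq q ^ 4) • (Pi.single .zed 1 : G1 q) .plus)
    rw [smul_oneForm] at h1 h2
    have e1 := congrFun (oneForm_injective q (hy.symm.trans h1)) .plus
    have e2 := congrFun (oneForm_injective q (hw.symm.trans h2)) .zed
    rw [hy2] at e1
    rw [hw3] at e2
    simp only [Pi.smul_apply, Pi.single_eq_same, smul_smul] at e1 e2
    have f := (smul_left_injective ℂ (one_ne_zero (α := ASU q)) e1).trans
      (smul_left_injective ℂ (one_ne_zero (α := ASU q)) e2).symm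
    field_simp at f
    linear_combination f
  -- compare the components of `T(ω₋*)` and `T(ω₋)*` at `ω_z ∧ ω₊`
  have hre : (starRingEnd ℂ) (g .plus .minus) = cq q ^ 6 * g .minus .plus := by
    have h := hreal .minus
    rw [om_eq, estar_oneForm, hT.apply_oneForm hc hm, hT.apply_oneForm hc hm, twoForm, twoForm,
      estar_toExt] at h
    have e := congrFun (congrFun ((toExt_eq_iff q _ _).1 h).2.2.1 .zed) .plus
    have hcs := fun η : G2 q => asym2_cases q η
    simp [hcs, tstar, twoTens, bar, tau, hq, ← neg_smul] at e
    rw [conj_cq] at e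
    field_simp at e
    linear_combination -e
  have hαr : ((g .minus .plus).re : ℂ) = g .minus .plus := by
    rw [hsym, map_mul, map_pow, conj_cq] at hre
    exact Complex.conj_eq_iff_re.1 (mul_left_cancel₀ (pow_ne_zero 6 hq) hre)
  refine ⟨hc, (g .minus .plus).re, fun h => hα ?_, hαr.symm, by rw [hαr, hsym]⟩
  rw [← hαr, h, Complex.ofReal_zero]

/-! ### Forms on the Podleś sphere in coordinates -/

/-- The form `f + v ω₋ + w ω₊ + k ω₋ ∧ ω₊`. -/
def sphereForm {q : Param} (f v w k : ASU q) : Ext q :=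
  toExt q (f, fun | .minus => v | .plus => w | .zed => 0, twoTens k 0 0, 0)

theorem sphereForm_add (q : Param) (f v w k f' v' w' k' : ASU q) :
    sphereForm (f + f') (v + v') (w + w') (k + k') =
      sphereForm f v w k + sphereForm f' v' w' k' := by
  rw [sphereForm, sphereForm, sphereForm, ← map_add]
  congr 1
  refine Prod.ext rfl (Prod.ext ?_ (Prod.ext ?_ (add_zero _).symm))
  · funext a; cases a <;> simp
  · funext a b; cases a <;> cases b <;> simp [twoTens]

theorem sphereForm_smul (q : Param) (x f v w k : ASU q) :
    sphereForm (x * f) (x * v) (x * w) (x * k) = x • sphereForm f v w k := by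
  rw [sphereForm, sphereForm, ← map_smul]
  congr 1
  refine Prod.ext rfl (Prod.ext ?_ (Prod.ext ?_ (smul_zero x).symm))
  · funext a; cases a <;> simp
  · funext a b; cases a <;> cases b <;> simp [twoTens]

theorem sphereForm_smul' (q : Param) (c : ℂ) (f v w k : ASU q) :
    sphereForm (c • f) (c • v) (c • w) (c • k) = c • sphereForm f v w k := by
  rw [← one_smul (ASU q) (sphereForm f v w k), ← smul_assoc, ← sphereForm_smul]
  simp

theorem oneE_eq (q : Param) : oneE q = sphereForm 1 0 0 0 := by
  rw [oneE, sphereForm, toExt_eq_iff]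
  refine ⟨rfl, ?_, ?_, rfl⟩
  · funext a; cases a <;> rfl
  · congr 1; funext a b; cases a <;> cases b <;> rfl

theorem om_minus_eq (q : Param) : om q .minus = sphereForm 0 1 0 0 := by
  rw [om, sphereForm, toExt_eq_iff]
  refine ⟨rfl, ?_, ?_, rfl⟩
  · funext a; cases a <;> simp
  · congr 1; funext a b; cases a <;> cases b <;> rfl

theorem om_plus_eq (q : Param) : om q .plus = sphereForm 0 0 1 0 := by
  rw [om, sphereForm, toExt_eq_iff]
  refine ⟨rfl, ?_, ?_, rfl⟩
  · funext a; cases a <;> simp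
  · congr 1; funext a b; cases a <;> cases b <;> rfl

theorem omMP_eq_sphereForm (q : Param) : omMP q = sphereForm 0 0 0 1 := by
  rw [omMP_eq, sphereForm, twoForm, toExt_eq_iff]
  refine ⟨rfl, ?_, rfl, rfl⟩
  funext a; cases a <;> rfl

theorem sphereForm_eq (q : Param) (f v w k : ASU q) : sphereForm f v w k =
    f • oneE q + (v • om q .minus + w • om q .plus) + k • omMP q := by
  rw [oneE_eq, om_minus_eq, om_plus_eq, omMP_eq_sphereForm]
  simp only [← sphereForm_smul, ← sphereForm_add]
  simp

theorem mem_Omega (q : Param) (φ : Ext q) : φ ∈ Omega q ↔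
    ∃ f ∈ line q 0, ∃ v ∈ line q (-2), ∃ w ∈ line q 2, ∃ k ∈ line q 0,
      φ = sphereForm f v w k := by
  simp only [sphereForm_eq]
  exact Iff.rfl

/-- The coefficient `f` of a form. -/
def coef0 (q : Param) : Ext q →ₗ[ASU q] ASU q :=
  LinearMap.fst _ _ _ ∘ₗ tens q

/-- The coefficient of `ω_a` in a form. -/
def coef1 (q : Param) (a : Idx) : Ext q →ₗ[ASU q] ASU q :=
  LinearMap.proj a ∘ₗ LinearMap.fst _ _ _ ∘ₗ LinearMap.snd _ _ _ ∘ₗ tens q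

/-- The coefficient of `ω₋ ∧ ω₊` in a form, up to the factor `q²`: the antisymmetric tensor
`ω₋ ∧ ω₊` is `q² ω₋ ⊗ ω₊ - q⁻² ω₊ ⊗ ω₋`. -/
def coef2 (q : Param) : Ext q →ₗ[ASU q] ASU q :=
  LinearMap.proj .plus ∘ₗ LinearMap.proj .minus ∘ₗ LinearMap.fst _ _ _ ∘ₗ LinearMap.snd _ _ _ ∘ₗ
    LinearMap.snd _ _ _ ∘ₗ tens q

theorem coef0_sphereForm (q : Param) (f v w k : ASU q) : coef0 q (sphereForm f v w k) = f := rfl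
theorem coef1_minus_sphereForm (q : Param) (f v w k : ASU q) :
    coef1 q .minus (sphereForm f v w k) = v := rfl
theorem coef1_plus_sphereForm (q : Param) (f v w k : ASU q) :
    coef1 q .plus (sphereForm f v w k) = w := rfl
theorem coef2_sphereForm (q : Param) (f v w k : ASU q) :
    coef2 q (sphereForm f v w k) = cq q ^ 2 • k := by
  change asym2 q (twoTens k 0 0) .minus .plus = _
  rw [(asym2_cases q _).2.2.2.1]
  simp [twoTens]

theorem sphereForm_eq_iff (q : Param) (f v w k f' v' w' k' : ASU q) :
    sphereForm f v w k = sphereForm f' v' w' k' ↔ f = f' ∧ v = v' ∧ w = w' ∧ k = k' := by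
  refine ⟨fun h => ⟨?_, ?_, ?_, ?_⟩, fun ⟨h1, h2, h3, h4⟩ => by rw [h1, h2, h3, h4]⟩
  · exact congrArg (coef0 q) h
  · exact congrArg (coef1 q .minus) h
  · exact congrArg (coef1 q .plus) h
  · have := congrArg (coef2 q) h
    rw [coef2_sphereForm, coef2_sphereForm] at this
    exact smul_right_injective _ (pow_ne_zero 2 (cq_ne_zero q)) this

theorem isHomog_sphereForm (q : Param) (f v w k : ASU q) :
    (IsHomog q 0 (sphereForm f v w k) ↔ v = 0 ∧ w = 0 ∧ k = 0) ∧
    (IsHomog q 1 (sphereForm f v w k) ↔ f = 0 ∧ k = 0) ∧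
    (IsHomog q 2 (sphereForm f v w k) ↔ f = 0 ∧ v = 0 ∧ w = 0) := by
  have h1 : (0 : G1 q) = (fun | .minus => v | .plus => w | .zed => 0) ↔ v = 0 ∧ w = 0 := by
    constructor
    · intro h
      exact ⟨(congrFun h .minus).symm, (congrFun h .plus).symm⟩
    · rintro ⟨rfl, rfl⟩
      funext a; cases a <;> rfl
  have h2 : 0 = asym2 q (twoTens k 0 0) ↔ k = 0 := by
    constructor
    · intro h
      have e := congrFun (congrFun h .minus) .plus
      rw [(asym2_cases q _).2.2.2.1] at e
      simpa [twoTens, cq_ne_zero] using e.symm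
    · rintro rfl
      have : (twoTens 0 0 0 : G2 q) = 0 := by
        funext a b; cases a <;> cases b <;> rfl
      rw [this, map_zero]
  refine ⟨?_, ?_, ?_⟩ <;>
    simp [IsHomog, sphereForm, tens_toExt_eq, degPart, h1, h2, and_assoc, eq_comm (a := (0 : ASU q))]

/-! ### The dual operator on the Podleś sphere -/

theorem integral_two (q : Param) {m : ℂ} (hm : m ≠ 0) (t : Tens q)
    (h1 : t.2.2.1 .minus .zed = 0) (h2 : t.2.2.1 .zed .minus = 0) (h3 : t.2.2.1 .zed .plus = 0)
    (h4 : t.2.2.1 .plus .zed = 0) :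
    integral q 2 (m • omMP q) (toExt q t) =
      m⁻¹ * haar q (t.2.2.1 .minus .plus - cq q ^ 2 • t.2.2.1 .plus .minus) := by
  have hq := cq_ne_zero q
  set c := t.2.2.1 .minus .plus - cq q ^ 2 • t.2.2.1 .plus .minus with hc
  have key : ∀ x : ASU q, degPart q 2 (tens q (toExt q t)) = tens q (x • m • omMP q) ↔
      x = m⁻¹ • c := by
    intro x
    have e : x • m • omMP q = toExt q (0, 0, twoTens (m • x) 0 0, 0) := by
      rw [omMP_eq_sphereForm, ← sphereForm_smul', ← sphereForm_smul, sphereForm, toExt_eq_iff]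
      refine ⟨by simp, ?_, ?_, rfl⟩
      · funext a; cases a <;> simp
      · simp
    have e2 : asym2 q t.2.2.1 = asym2 q (twoTens c 0 0) := by
      rw [asym2_twoTens, h1, h2, h3, h4]
      simp [hc]
    have e3 : degPart q 2 (tens q (toExt q t)) = tens q (toExt q (0, 0, twoTens c 0 0, 0)) := by
      simp [tens_toExt_eq, degPart, e2]
    rw [e, e3, (tens_injective q).eq_iff]
    change twoForm c 0 0 = twoForm (m • x) 0 0 ↔ _
    rw [twoForm_eq_iff]
    constructor
    · rintro ⟨h, -⟩
      rw [h, smul_smul, inv_mul_cancel₀ hm, one_smul]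
    · rintro rfl
      simp [smul_smul, hm]
  unfold integral
  simp only [key]
  rw [Classical.epsilon_spec (p := fun x => x = m⁻¹ • c) ⟨_, rfl⟩, map_smul, smul_eq_mul]

theorem integral_sphereForm (q : Param) {m : ℂ} (hm : m ≠ 0) (f v w k f' v' w' k' : ASU q) :
    integral q 2 (m • omMP q)
        (wedge q (estar q (sphereForm f v w k)) (sphereForm f' v' w' k')) =
      m⁻¹ * (haar q (star f * k') + cq q ^ 2 * haar q (star v * v') - haar q (star w * w')
        - haar q (star k * f')) := by
  rw [sphereForm, sphereForm, estar_toExt, wedge_toExt, integral_two q hm]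
  · simp only [tmul, tstar, twoTens, bar, zero_mul, mul_zero, map_zero, zero_add, add_zero,
      smul_zero, sub_zero, zero_sub, Pi.zero_apply, neg_mul, mul_neg, smul_neg, neg_neg, map_sub,
      map_add, map_smul, map_neg, ← map_mul, tau, haar_twist, smul_eq_mul, star_zero, neg_zero]
    ring
  all_goals simp [tmul, tstar, twoTens, bar]

theorem scalarProd_sphereForm (q : Param) {g : Matrix Idx Idx ℂ}
    (hg : ∀ a b, charge a + charge b ≠ 0 → g a b = 0) (f v w k f' v' w' k' : ASU q) :
    scalarProd q g (sphereForm f v w k) (sphereForm f' v' w' k') =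
      haar q (star f * f') - g .plus .minus * haar q (star v * v')
        - g .minus .plus * haar q (star w * w')
        + 2 * (lam2 q)⁻¹ * g .minus .plus * g .plus .minus * haar q (star k * k') := by
  obtain ⟨h1, h2, h3, h4, h5, h6⟩ := contraction_eq_zero hg
  have hc := fun η : G2 q => asym2_cases q η
  have hs : star (cq q) = cq q := conj_cq q
  have hq := cq_ne_zero q
  simp only [scalarProd, sphereForm, tens_toExt_eq, sum_idx, bar, h1, h2, h3, h4, h5, h6, map_zero,
    Pi.zero_apply, mul_zero, zero_mul, add_zero, zero_add, neg_zero, star_zero, hc, twoTens,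
    smul_zero, sub_zero, star_smul, star_neg, star_pow, star_inv₀, hs, smul_mul_smul_comm,
    map_smul, smul_eq_mul, neg_smul, neg_mul, mul_neg, map_neg, neg_neg]
  field_simp
  ring

/-- The form `f + v ω₋ + w ω₊ + k ω₋ ∧ ω₊` as an element of `Ω(S²_q)`. -/
def omegaForm {q : Param} {f v w k : ASU q} (hf : f ∈ line q 0) (hv : v ∈ line q (-2))
    (hw : w ∈ line q 2) (hk : k ∈ line q 0) : Omega q :=
  ⟨sphereForm f v w k, (mem_Omega q _).2 ⟨f, hf, v, hv, w, hw, k, hk, rfl⟩⟩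

/-- The operator with `1 ↦ c₀ ω₋ ∧ ω₊`, `ω₋ ∧ ω₊ ↦ c₂ 1`, `ω₋ ↦ cm ω₋` and `ω₊ ↦ cp ω₊`. -/
def sphereOp (q : Param) (c₀ cm cp c₂ : ℂ) : Omega q →ₗ[sphere q] Omega q where
  toFun ψ := ⟨sphereForm (c₂ • (cq q ^ 2)⁻¹ • coef2 q ψ) (cm • coef1 q .minus ψ)
      (cp • coef1 q .plus ψ) (c₀ • coef0 q ψ), by
    obtain ⟨f, hf, v, hv, w, hw, k, hk, h⟩ := (mem_Omega q _).1 ψ.2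
    rw [h, coef0_sphereForm, coef1_minus_sphereForm, coef1_plus_sphereForm, coef2_sphereForm,
      inv_smul_smul₀ (pow_ne_zero 2 (cq_ne_zero q))]
    exact (mem_Omega q _).2 ⟨_, (line q 0).smul_mem _ hk, _, (line q (-2)).smul_mem _ hv, _,
      (line q 2).smul_mem _ hw, _, (line q 0).smul_mem _ hf, rfl⟩⟩
  map_add' ψ ψ' := by
    refine Subtype.ext ?_
    simp only [Submodule.coe_add, map_add, smul_add, sphereForm_add]
  map_smul' x ψ := by
    refine Subtype.ext ?_
    have e : ((x • ψ : Omega q) : Ext q) = (x : ASU q) • (ψ : Ext q) := rfl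
    simp only [e, map_smul, RingHom.id_apply, smul_eq_mul, ← mul_smul_comm, sphereForm_smul]
    rfl

theorem coe_sphereOp (q : Param) (c₀ cm cp c₂ : ℂ) {ψ : Omega q} {f v w k : ASU q}
    (h : (ψ : Ext q) = sphereForm f v w k) :
    (sphereOp q c₀ cm cp c₂ ψ : Ext q) =
      sphereForm (c₂ • k) (cm • v) (cp • w) (c₀ • f) := by
  change sphereForm _ _ _ _ = _
  rw [h, coef0_sphereForm, coef1_minus_sphereForm, coef1_plus_sphereForm, coef2_sphereForm,
    inv_smul_smul₀ (pow_ne_zero 2 (cq_ne_zero q))]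

/-- The explicit operator is dual to the scalar product. -/
theorem isDualSphere_sphereOp (q : Param) {g : Matrix Idx Idx ℂ}
    (hg : ∀ a b, charge a + charge b ≠ 0 → g a b = 0) {m : ℝ} (hm : m ≠ 0) :
    IsDualSphere q g m (sphereOp q (Complex.I * m)
      (-Complex.I * (cq q ^ 2)⁻¹ * m * g .plus .minus) (Complex.I * m * g .minus .plus)
      (-2 * Complex.I * m * g .minus .plus * g .plus .minus / lam2 q)) := by
  intro ψ ψ'
  have hq := cq_ne_zero q
  have hl := lam2_ne_zero q
  have hm' : (m : ℂ) ≠ 0 := by exact_mod_cast hm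
  have hIm : Complex.I * m ≠ 0 := mul_ne_zero Complex.I_ne_zero hm'
  obtain ⟨f, -, v, -, w, -, k, -, h⟩ := (mem_Omega q _).1 ψ.2
  obtain ⟨f', -, v', -, w', -, k', -, h'⟩ := (mem_Omega q _).1 ψ'.2
  rw [coe_sphereOp q _ _ _ _ h', h, h', scalarProd_sphereForm q hg, integral_sphereForm q hIm]
  simp only [mul_smul_comm, map_smul, smul_eq_mul]
  field_simp
  ring

/-- Nondegeneracy of the Haar state on the line bundles makes the dual operator unique. -/
theorem IsDualSphere.unique {q : Param} {g : Matrix Idx Idx ℂ} {m : ℝ} (hm : m ≠ 0)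
    {F G : Omega q → Omega q} (hF : IsDualSphere q g m F) (hG : IsDualSphere q g m G) : F = G := by
  have hq := cq_ne_zero q
  have hm' : (m : ℂ) ≠ 0 := by exact_mod_cast hm
  have hIm : Complex.I * m ≠ 0 := mul_ne_zero Complex.I_ne_zero hm'
  funext ψ
  obtain ⟨f, hf, v, hv, w, hw, k, hk, h⟩ := (mem_Omega q _).1 (F ψ).2
  obtain ⟨f', hf', v', hv', w', hw', k', hk', h'⟩ := (mem_Omega q _).1 (G ψ).2
  have key : ∀ {a b c d : ASU q} (_ : a ∈ line q 0) (_ : b ∈ line q (-2)) (_ : c ∈ line q 2)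
      (_ : d ∈ line q 0), haar q (star a * (k - k')) + cq q ^ 2 * haar q (star b * (v - v'))
        - haar q (star c * (w - w')) - haar q (star d * (f - f')) = 0 := by
    intro a b c d ha hb hc hd
    have e := (hF (omegaForm ha hb hc hd) ψ).symm.trans (hG (omegaForm ha hb hc hd) ψ)
    rw [h, h', omegaForm, integral_sphereForm q hIm, integral_sphereForm q hIm] at e
    have e' := mul_left_cancel₀ (inv_ne_zero hIm) e
    simp only [mul_sub, map_sub]
    linear_combination e'
  refine Subtype.ext ?_
  rw [h, h', sphereForm_eq_iff]
  refine ⟨?_, ?_, ?_, ?_⟩ <;> rw [← sub_eq_zero]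
  · refine eq_zero_of_haar_line q (sub_mem hf hf') fun x hx => ?_
    simpa using key (zero_mem _) (zero_mem _) (zero_mem _) hx
  · refine eq_zero_of_haar_line q (sub_mem hv hv') fun x hx => ?_
    simpa [hq] using key (zero_mem _) hx (zero_mem _) (zero_mem _)
  · refine eq_zero_of_haar_line q (sub_mem hw hw') fun x hx => ?_
    simpa using key (zero_mem _) (zero_mem _) hx (zero_mem _)
  · refine eq_zero_of_haar_line q (sub_mem hk hk') fun x hx => ?_
    simpa using key hx (zero_mem _) (zero_mem _) (zero_mem _)

theorem coe_form0 (q : Param) (f : sphere q) : (form0 q f : Ext q) = sphereForm (f : ASU q) 0 0 0 := by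
  simp [form0, sphereForm_eq]
theorem coe_formMinus (q : Param) (v : line q (-2)) :
    (formMinus q v : Ext q) = sphereForm 0 (v : ASU q) 0 0 := by
  simp [formMinus, sphereForm_eq]
theorem coe_formPlus (q : Param) (v : line q 2) :
    (formPlus q v : Ext q) = sphereForm 0 0 (v : ASU q) 0 := by
  simp [formPlus, sphereForm_eq]
theorem coe_form2 (q : Param) (f : sphere q) : (form2 q f : Ext q) = sphereForm 0 0 0 (f : ASU q) := by
  simp [form2, sphereForm_eq]

/-- The elements `a²` and `a*²` of `L₋₂` and `L₂` have counit `1`. -/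
theorem exists_line_ne_zero (q : Param) :
    (∃ v : line q (-2), (v : ASU q) ≠ 0) ∧ ∃ w : line q 2, (w : ASU q) ≠ 0 := by
  have ha : gen q .a ∈ line q (-1) := by
    simp [mem_line, coact, comul, genComul, proj, genProj]
  have has : gen q .as ∈ line q 1 := by
    simp [mem_line, coact, comul, genComul, proj, genProj]
  have ha2 : gen q .a * gen q .a ∈ line q (-2) := by
    have := mul_mem_line q ha ha
    rwa [show (-1 : ℤ) + -1 = -2 by norm_num] at this
  have has2 : gen q .as * gen q .as ∈ line q 2 := by
    have := mul_mem_line q has has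
    rwa [show (1 : ℤ) + 1 = 2 by norm_num] at this
  constructor
  · refine ⟨⟨_, ha2⟩, fun h => ?_⟩
    have e := congrArg (counit q) h
    simp only [map_mul, counit_gen, mul_one, map_zero] at e
    exact one_ne_zero e
  · refine ⟨⟨_, has2⟩, fun h => ?_⟩
    have e := congrArg (counit q) h
    simp only [map_mul, counit_gen, mul_one, map_zero] at e
    exact one_ne_zero e

theorem isHomog_sphereOp (q : Param) (c₀ cm cp c₂ : ℂ) (s : ℕ) (hs : s ≤ 2) (ψ : Omega q)
    (h : IsHomog q s ψ) : IsHomog q (2 - s) (sphereOp q c₀ cm cp c₂ ψ) := by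
  obtain ⟨f, -, v, -, w, -, k, -, e⟩ := (mem_Omega q _).1 ψ.2
  have hψ := isHomog_sphereForm q f v w k
  have hT := isHomog_sphereForm q (c₂ • k) (cm • v) (cp • w) (c₀ • f)
  rw [coe_sphereOp q _ _ _ _ e]
  rw [e] at h
  interval_cases s
  · obtain ⟨rfl, rfl, rfl⟩ := hψ.1.1 h
    exact hT.2.2.2 (by simp)
  · obtain ⟨rfl, rfl⟩ := hψ.2.1.1 h
    exact hT.2.1.2 (by simp)
  · obtain ⟨rfl, rfl, rfl⟩ := hψ.2.2.1 h
    exact hT.1.2 (by simp)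

theorem coe_smul_Omega (q : Param) (c : ℂ) (ψ : Omega q) :
    ((c • ψ : Omega q) : Ext q) = c • (ψ : Ext q) := rfl

theorem sphereOp_form0 (q : Param) (c₀ cm cp c₂ : ℂ) (f : sphere q) :
    sphereOp q c₀ cm cp c₂ (form0 q f) = c₀ • form2 q f := by
  refine Subtype.ext ?_
  rw [coe_sphereOp q _ _ _ _ (coe_form0 q f), coe_smul_Omega, coe_form2, ← sphereForm_smul']
  simp only [smul_zero]

theorem sphereOp_form2 (q : Param) (c₀ cm cp c₂ : ℂ) (f : sphere q) :
    sphereOp q c₀ cm cp c₂ (form2 q f) = c₂ • form0 q f := by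
  refine Subtype.ext ?_
  rw [coe_sphereOp q _ _ _ _ (coe_form2 q f), coe_smul_Omega, coe_form0, ← sphereForm_smul']
  simp only [smul_zero]

theorem sphereOp_formMinus (q : Param) (c₀ cm cp c₂ : ℂ) (v : line q (-2)) :
    sphereOp q c₀ cm cp c₂ (formMinus q v) = cm • formMinus q v := by
  refine Subtype.ext ?_
  rw [coe_sphereOp q _ _ _ _ (coe_formMinus q v), coe_smul_Omega, coe_formMinus,
    ← sphereForm_smul']
  simp only [smul_zero]

theorem sphereOp_formPlus (q : Param) (c₀ cm cp c₂ : ℂ) (v : line q 2) :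
    sphereOp q c₀ cm cp c₂ (formPlus q v) = cp • formPlus q v := by
  refine Subtype.ext ?_
  rw [coe_sphereOp q _ _ _ _ (coe_formPlus q v), coe_smul_Omega, coe_formPlus,
    ← sphereForm_smul']
  simp only [smul_zero]

theorem sphereOp_smul (q : Param) (c₀ cm cp c₂ c : ℂ) (ψ : Omega q) :
    sphereOp q c₀ cm cp c₂ (c • ψ) = c • sphereOp q c₀ cm cp c₂ ψ :=
  LinearMap.map_smul_of_tower _ c ψ

/-- The square of the operator on the sphere is diagonal. -/
theorem sphereOp_sphereOp (q : Param) (c₀ cm cp c₂ : ℂ) :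
    (∀ f, sphereOp q c₀ cm cp c₂ (sphereOp q c₀ cm cp c₂ (form0 q f)) = (c₀ * c₂) • form0 q f) ∧
    (∀ f, sphereOp q c₀ cm cp c₂ (sphereOp q c₀ cm cp c₂ (form2 q f)) = (c₀ * c₂) • form2 q f) ∧
    (∀ v, sphereOp q c₀ cm cp c₂ (sphereOp q c₀ cm cp c₂ (formMinus q v)) =
      cm ^ 2 • formMinus q v) ∧
    (∀ v, sphereOp q c₀ cm cp c₂ (sphereOp q c₀ cm cp c₂ (formPlus q v)) =
      cp ^ 2 • formPlus q v) := by
  refine ⟨fun f => ?_, fun f => ?_, fun v => ?_, fun v => ?_⟩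
  · rw [sphereOp_form0, sphereOp_smul, sphereOp_form2, smul_smul]
  · rw [sphereOp_form2, sphereOp_smul, sphereOp_form0, smul_smul, mul_comm]
  · rw [sphereOp_formMinus, sphereOp_smul, sphereOp_formMinus, smul_smul, sq]
  · rw [sphereOp_formPlus, sphereOp_smul, sphereOp_formPlus, smul_smul, sq]

theorem isHomog_formMinus (q : Param) (v : line q (-2)) : IsHomog q 1 (formMinus q v) := by
  rw [coe_formMinus]
  exact (isHomog_sphereForm q _ _ _ _).2.1.2 ⟨rfl, rfl⟩

theorem isHomog_formPlus (q : Param) (v : line q 2) : IsHomog q 1 (formPlus q v) := by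
  rw [coe_formPlus]
  exact (isHomog_sphereForm q _ _ _ _).2.1.2 ⟨rfl, rfl⟩

theorem eq_of_smul_formMinus (q : Param) {v : line q (-2)} (hv : (v : ASU q) ≠ 0) {c d : ℂ}
    (h : c • formMinus q v = d • formMinus q v) : c = d := by
  have e := congrArg (coef1 q .minus) (congrArg Subtype.val h)
  rw [coe_smul_Omega, coe_smul_Omega, coe_formMinus, ← sphereForm_smul', ← sphereForm_smul',
    coef1_minus_sphereForm, coef1_minus_sphereForm] at e
  exact smul_left_injective ℂ hv e

theorem eq_of_smul_formPlus (q : Param) {v : line q 2} (hv : (v : ASU q) ≠ 0) {c d : ℂ}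
    (h : c • formPlus q v = d • formPlus q v) : c = d := by
  have e := congrArg (coef1 q .plus) (congrArg Subtype.val h)
  rw [coe_smul_Omega, coe_smul_Omega, coe_formPlus, ← sphereForm_smul', ← sphereForm_smul',
    coef1_plus_sphereForm, coef1_plus_sphereForm] at e
  exact smul_left_injective ℂ hv e

end

end PodlesHodge

theorem mainTheorem2 (q : Param) (g : Matrix Idx Idx ℂ) (hg : g ∈ hodgeContractions q) :
    (∃ m : ℝ, m ≠ 0 ∧ (m : ℂ) ^ 2 = lam2 q * g .minus .plus * g .plus .minus / 2) ∧
    (∃ m : ℝ, m ≠ 0 ∧ (m : ℂ) ^ 2 = lam2 q / (2 * g .minus .plus * g .plus .minus)) ∧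
    ∀ m : ℝ, m ≠ 0 → ∃ T : Omega q →ₗ[sphere q] Omega q,
      -- `T` is the unique dual operator, and it maps `Ω^s` to `Ω^(2-s)`
      IsDualSphere q g m T ∧
      (∀ F : Omega q → Omega q, IsDualSphere q g m F → F = T) ∧
      (∀ s ≤ 2, ∀ ψ : Omega q, IsHomog q s ψ → IsHomog q (2 - s) (T ψ)) ∧
      -- the explicit form of `T`
      T (form0 q 1) = (Complex.I * m) • form2 q 1 ∧
      (∀ v : line q (-2), T (formMinus q v) =
        (-Complex.I * (cq q ^ 2)⁻¹ * m * g .plus .minus) • formMinus q v) ∧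
      (∀ v : line q 2, T (formPlus q v) = (Complex.I * m * g .minus .plus) • formPlus q v) ∧
      T (form2 q 1) =
        (-2 * Complex.I * m * g .minus .plus * g .plus .minus / lam2 q) • form0 q 1 ∧
      -- `T²` is diagonal
      (∀ f, T (T (form0 q f)) =
        (2 * (m : ℂ) ^ 2 * g .minus .plus * g .plus .minus / lam2 q) • form0 q f) ∧
      (∀ f, T (T (form2 q f)) =
        (2 * (m : ℂ) ^ 2 * g .minus .plus * g .plus .minus / lam2 q) • form2 q f) ∧
      (∀ v, T (T (formMinus q v)) =
        (-(cq q ^ 4)⁻¹ * (m : ℂ) ^ 2 * g .plus .minus ^ 2) • formMinus q v) ∧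
      (∀ v, T (T (formPlus q v)) = (-(m : ℂ) ^ 2 * g .minus .plus ^ 2) • formPlus q v) ∧
      -- `T²` is not constant on one-forms
      (¬ ∃ ζ : ℂ, ∀ ψ : Omega q, IsHomog q 1 ψ → T (T ψ) = ζ • ψ) ∧
      -- the two normalisations of the volume form
      ((m : ℂ) ^ 2 = lam2 q * g .minus .plus * g .plus .minus / 2 →
        (∀ f, T (T (form0 q f)) = (g .minus .plus * g .plus .minus) ^ 2 • form0 q f) ∧
        (∀ f, T (T (form2 q f)) = (g .minus .plus * g .plus .minus) ^ 2 • form2 q f) ∧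
        (∀ v, T (T (formMinus q v)) =
          (-(lam2 q * g .minus .plus * g .plus .minus ^ 3 / (2 * cq q ^ 4))) • formMinus q v) ∧
        (∀ v, T (T (formPlus q v)) =
          (-(lam2 q * g .minus .plus ^ 3 * g .plus .minus / 2)) • formPlus q v)) ∧
      ((m : ℂ) ^ 2 = lam2 q / (2 * g .minus .plus * g .plus .minus) →
        (∀ f, T (T (form0 q f)) = form0 q f) ∧
        (∀ f, T (T (form2 q f)) = form2 q f) ∧
        (∀ v, T (T (formMinus q v)) = (-(cq q ^ 2 * lam2 q / 2)) • formMinus q v) ∧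
        (∀ v, T (T (formPlus q v)) = (-(lam2 q / (2 * cq q ^ 6))) • formPlus q v)) := by
  have hq := cq_ne_zero q
  have hl := lam2_ne_zero q
  have hI := Complex.I_sq
  obtain ⟨hc, α, hα, hgα, hgβ⟩ := hodgeContractions_spec q hg
  have hα' : (α : ℂ) ≠ 0 := by exact_mod_cast hα
  have hq0 := q.2.1
  have hsqrt : ∀ x : ℝ, 0 < x → ∃ m : ℝ, m ≠ 0 ∧ (m : ℂ) ^ 2 = x := fun x hx =>
    ⟨√x, (Real.sqrt_pos.2 hx).ne', by rw [← Complex.ofReal_pow, Real.sq_sqrt hx.le]⟩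
  refine ⟨?_, ?_, fun m hm => ?_⟩
  · obtain ⟨m, hm, e⟩ := hsqrt ((1 + (q : ℝ) ^ 2) * α * ((q : ℝ) ^ 6 * α) / 2) (by
      have := sq_pos_of_ne_zero hα
      have e : (1 + (q : ℝ) ^ 2) * α * ((q : ℝ) ^ 6 * α) / 2
        = (1 + (q : ℝ) ^ 2) * (q : ℝ) ^ 6 * α ^ 2 / 2 := by ring
      rw [e]
      positivity)
    refine ⟨m, hm, ?_⟩
    rw [e, hgα, hgβ, lam2, cq]
    push_cast
    ring
  · obtain ⟨m, hm, e⟩ := hsqrt ((1 + (q : ℝ) ^ 2) / (2 * α * ((q : ℝ) ^ 6 * α))) (by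
      have := sq_pos_of_ne_zero hα
      have e : 2 * α * ((q : ℝ) ^ 6 * α) = 2 * (q : ℝ) ^ 6 * α ^ 2 := by ring
      rw [e]
      positivity)
    refine ⟨m, hm, ?_⟩
    rw [e, hgα, hgβ, lam2, cq]
    push_cast
    ring
  have hm' : (m : ℂ) ≠ 0 := by exact_mod_cast hm
  have hdual := isDualSphere_sphereOp q hc hm
  rw [hgα, hgβ] at hdual ⊢
  set c₀ : ℂ := Complex.I * m with hc₀
  set cm : ℂ := -Complex.I * (cq q ^ 2)⁻¹ * m * (cq q ^ 6 * α) with hcm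
  set cp : ℂ := Complex.I * m * α with hcp
  set c₂ : ℂ := -2 * Complex.I * m * α * (cq q ^ 6 * α) / lam2 q with hc₂
  obtain ⟨s0, s2, sm, sp⟩ := sphereOp_sphereOp q c₀ cm cp c₂
  have e02 : c₀ * c₂ = 2 * (m : ℂ) ^ 2 * α * (cq q ^ 6 * α) / lam2 q := by
    rw [hc₀, hc₂]
    linear_combination (-2 * (m : ℂ) ^ 2 * α * (cq q ^ 6 * α) / lam2 q) * hI
  have em : cm ^ 2 = -(cq q ^ 4)⁻¹ * (m : ℂ) ^ 2 * (cq q ^ 6 * α) ^ 2 := by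
    have e4 : (cq q ^ 4)⁻¹ = ((cq q ^ 2)⁻¹) ^ 2 := by ring
    rw [hcm, e4]
    linear_combination (((cq q ^ 2)⁻¹) ^ 2 * (m : ℂ) ^ 2 * (cq q ^ 6 * α) ^ 2) * hI
  have ep : cp ^ 2 = -(m : ℂ) ^ 2 * α ^ 2 := by
    rw [hcp]
    linear_combination ((m : ℂ) ^ 2 * α ^ 2) * hI
  rw [e02] at s0 s2
  rw [em] at sm
  rw [ep] at sp
  refine ⟨sphereOp q c₀ cm cp c₂, hdual, fun F hF => hF.unique hm hdual,
    isHomog_sphereOp q c₀ cm cp c₂, sphereOp_form0 q _ _ _ _ 1, sphereOp_formMinus q _ _ _ _,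
    sphereOp_formPlus q _ _ _ _, sphereOp_form2 q _ _ _ _ 1, s0, s2, sm, sp, ?_, fun h => ?_,
    fun h => ?_⟩
  · rintro ⟨ζ, hζ⟩
    obtain ⟨⟨v, hv⟩, w, hw⟩ := exists_line_ne_zero q
    have h1 := eq_of_smul_formMinus q hv ((sm v).symm.trans (hζ _ (isHomog_formMinus q v)))
    have h2 := eq_of_smul_formPlus q hw ((sp w).symm.trans (hζ _ (isHomog_formPlus q w)))
    have h3 := h1.trans h2.symm
    -- the two eigenvalues differ by the factor `q⁸`
    have h4 : cq q ^ 8 = 1 := by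
      field_simp at h3
      exact neg_injective h3
    have h5 : (q : ℝ) ^ 8 = 1 := by
      unfold cq at h4
      exact_mod_cast h4
    exact (pow_lt_one₀ q.2.1.le q.2.2 (by norm_num)).ne h5
  · refine ⟨fun f => ?_, fun f => ?_, fun v => ?_, fun v => ?_⟩
    · rw [s0, h]; congr 1; field_simp
    · rw [s2, h]; congr 1; field_simp
    · rw [sm, h]; congr 1; field_simp
    · rw [sp, h]; congr 1; field_simp
  · refine ⟨fun f => ?_, fun f => ?_, fun v => ?_, fun v => ?_⟩
    · rw [s0, h]; convert one_smul ℂ _; field_simp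
    · rw [s2, h]; convert one_smul ℂ _; field_simp
    · rw [sm, h]; congr 1; field_simp
    · rw [sp, h]; congr 1; field_simp
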